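/- Let $\mathcal A$ be an alphabet with $d\ge 2$ letters, let $\pi_t,\pi_b:\mathcal A\to\{1,\dots,d\}$ be bijections and let $\lambda_\alpha>0$ $(\alpha\in\mathcal A)$. Put $p_\alpha=\sum_{\pi_t(\beta)<\pi_t(\alpha)}\lambda_\beta$, $q_\alpha=\sum_{\pi_b(\beta)<\pi_b(\alpha)}\lambda_\beta$, $\lambda^*=\sum_\alpha\lambda_\alpha$, and let $T:[0,\lambda^*)\to[0,\lambda^*)$, $T(x)=x-p_\alpha+q_\alpha$ for $x\in[p_\alpha,p_\alpha+\lambda_\alpha)$, be the associated interval exchange map. Assume that $T$ is admissible, i.e. $\pi_t^{-1}(\{1,\dots,k\})\ne\pi_b^{-1}(\{1,\dots,k\})$ for $1\le k<d$, and has the Keane property: there are no $\alpha,\beta\in\mathcal A$ and $m\ge1$ with $T^m(p_\alpha)=p_\beta$ and $\pi_t(\beta)>1$. *Rauzy–Veech algorithm.* Let $\alpha_t=\pi_t^{-1}(d)$ and $\alpha_b=\pi_b^{-1}(d)$. The winner is the letter of $\{\alpha_t,\alpha_b\}$ with the larger length and the loser is the other one. $\mathcal V(T)$ is the interval exchange map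 obtained by subtracting the length of the loser from that of the winner and, in the row ($\pi_b$ if the winner is $\alpha_t$, $\pi_t$ if the winner is $\alpha_b$) in which the loser is last, moving the loser to the place immediately after the winner. Put $T(n)=\mathcal V^n(T)$. The $n$-th arrow, from $T(n)$ to $T(n+1)$, with winner $\alpha$ and loser $\beta$, has the matrix $B_n=\mathbb I+E_{\beta\alpha}$, and $B(m,n)=B_{n-1}\cdots B_m$ for $m\le n$. The Zorich times are $n_0=0$ and $n_{k+1}>n_k$ the largest integer such that the arrows from $T(n_k)$ to $T(n_{k+1})$ all have the same winner. The Marmi–Moussa–Yoccoz (MMY) times are $m_0=0$ and $m_{k+1}>m_k$ the largest integer such that not all letters of $\mathcal A$ are winners of arrows between $T(m_k)$ and $T(m_{k+1})$. Let $\|A\|=\sum_{i,j}|a_{ij}|$. *Gaps.* The discontinuity points of $T^n$, as an interval exchange map, are the endpoints $0$ and $\lambda^*$ together with the points $x\in[0,\lambda^*)$ such that $T^j(x)=p_\beta$ for some $0\le j<n$ and some $\beta$ with $\pi_t(\beta)>1$. Let $\Delta(T^n)$ be the minimal distance between two distinct such points. Consider the conditions - (A) there is $M$ with $\|B(m_k,m_{k+1})\|\le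 M$ for all $k\ge0$; - (Z) there is $M$ with $\|B(n_k,n_{k+1})\|\le M$ for all $k\ge0$; - (D) there is $c>0$ with $\Delta(T^n)\ge c/n$ for all $n\ge1$; - (U) there is $c>0$ with $\liminf_{n\to\infty}n\cdot|T^n(x)-x|\ge c$ for all $x\in[0,\lambda^*)$. Then: (i) (A) and (D) are equivalent. Quantitatively, if $\|B(m_k,m_{k+1})\|\le M$ for all $k\ge 0$, then $\Delta(T^n)>\dfrac{\lambda^*}{M^{4r}\,n}$ for all $n\ge1$, where $r=\max(2d-3,2)$. (ii) (D) implies (U). (iii) (U) implies (Z). -/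

import Mathlib

open Filter

noncomputable section

/-- The data of an interval exchange map on `d` intervals labelled by the alphabet `𝒜`:
the positions `top α`, `bot α` of the interval `α` before and after the map, and its length.
Positions are counted from `0`, so the position `π_t(α) ∈ {1, …, d}` is `top α + 1`, and
the last position `d` is `⊤ : Fin d`. Positivity of the lengths, admissibility and the Keane
property are the separate predicates `Positive`, `Admissible` and `Keane`. -/
structure IEM (𝒜 : Type*) (d : ℕ) where
  top : 𝒜 ≃ Fin d
  bot : 𝒜 ≃ Fin d
  len : 𝒜 → ℝ

namespace IEM

variable {𝒜 : Type*} [Fintype 𝒜] {d : ℕ}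

/-- All the intervals have positive length. -/
def Positive (T : IEM 𝒜 d) : Prop := ∀ α, 0 < T.len α

/-- `p_α`, the left endpoint of the interval `I_α`. -/
def p (T : IEM 𝒜 d) (α : 𝒜) : ℝ := ∑ β with T.top β < T.top α, T.len β

/-- `q_α`, the left endpoint of the image of `I_α`. -/
def q (T : IEM 𝒜 d) (α : 𝒜) : ℝ := ∑ β with T.bot β < T.bot α, T.len β

/-- `λ^*`, the total length. -/
def total (T : IEM 𝒜 d) : ℝ := ∑ α, T.len α

/-- The map `x ↦ x - p_α + q_α` for `x ∈ I_α = [p_α, p_α + λ_α)`. The intervals `I_α` are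
disjoint with union `[0, λ^*)`, so at most one term of the sum is non-zero; outside of
`[0, λ^*)` the function is the identity. -/
def map (T : IEM 𝒜 d) (x : ℝ) : ℝ :=
  x + ∑ α, (Set.Ico (T.p α) (T.p α + T.len α)).indicator (fun _ => T.q α - T.p α) x

/-- For `1 ≤ k < d` the first `k` intervals before and after the map are never the same. -/
def Admissible (T : IEM 𝒜 d) : Prop :=
  ∀ k : ℕ, 1 ≤ k → k < d → {α | (T.top α : ℕ) < k} ≠ {α | (T.bot α : ℕ) < k}

/-- The Keane property: there are no `α`, `β` and `m ≥ 1` such that `T^m(p_α) = p_β`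
and `I_β` is not the leftmost interval. -/
def Keane (T : IEM 𝒜 d) : Prop :=
  ¬ ∃ (α β : 𝒜) (m : ℕ), 1 ≤ m ∧ 0 < (T.top β : ℕ) ∧ T.map^[m] (T.p α) = T.p β

/-! ### Rauzy–Veech induction -/

/-- The permutation of the positions which takes the last position to the one
just after `j` and shifts the positions strictly between by one. -/
def insertAfter [NeZero d] (j : Fin d) : Equiv.Perm (Fin d) := Fin.cycleIcc (j + 1) ⊤

theorem insertAfter_apply [NeZero d] (j i : Fin d) (hj : j < ⊤) :
    (insertAfter j i : ℕ) =
      if i ≤ j then (i : ℕ) else if i = ⊤ then (j : ℕ) + 1 else (i : ℕ) + 1 := by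
  have hj1 : ((j + 1 : Fin d) : ℕ) = (j : ℕ) + 1 := Fin.val_add_one_of_lt' (by
    have := Fin.lt_def.mp hj
    have := (⊤ : Fin d).isLt
    omega)
  unfold insertAfter
  split_ifs with h1 h2
  · rw [Fin.cycleIcc_of_lt]
    rw [Fin.lt_def, hj1]
    have := Fin.le_def.mp h1
    omega
  · subst h2
    rw [Fin.cycleIcc_of_last le_top, hj1]
  · have hi : i < ⊤ := lt_of_le_of_ne le_top h2
    rw [Fin.cycleIcc_of_ge_of_lt _ hi]
    · exact Fin.val_add_one_of_lt' (by
        have := Fin.lt_def.mp hi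
        have := (⊤ : Fin d).isLt
        omega)
    · rw [Fin.le_def, hj1]
      have := Fin.lt_def.mp (not_le.mp h1)
      omega

/-- `α_t`, the letter of the last interval before the map. -/
def lastTop [NeZero d] (T : IEM 𝒜 d) : 𝒜 := T.top.symm ⊤

/-- `α_b`, the letter of the last interval after the map. -/
def lastBot [NeZero d] (T : IEM 𝒜 d) : 𝒜 := T.bot.symm ⊤

open Classical in
/-- The winner is the longer one of the intervals `α_t`, `α_b`. It is `α_t` for maps of top type and
`α_b` for maps of bottom type. -/
def winner [NeZero d] (T : IEM 𝒜 d) : 𝒜 :=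
  if T.len T.lastBot ≤ T.len T.lastTop then T.lastTop else T.lastBot

open Classical in
/-- The loser is the other one of the two letters `α_t`, `α_b`. -/
def loser [NeZero d] (T : IEM 𝒜 d) : 𝒜 :=
  if T.len T.lastBot ≤ T.len T.lastTop then T.lastBot else T.lastTop

open Classical in
/-- One step `T ↦ 𝒱(T)` of the Rauzy–Veech algorithm: the length of the loser is subtracted from
that of the winner; and in the row (bottom row for top type, top row for bottom type) in which the
loser is last, the loser is moved to the place just after the winner. -/
def rauzy [NeZero d] (T : IEM 𝒜 d) : IEM 𝒜 d where
  top := if T.len T.lastBot ≤ T.len T.lastTop then T.top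
    else T.top.trans (insertAfter (T.top T.winner))
  bot := if T.len T.lastBot ≤ T.len T.lastTop then T.bot.trans (insertAfter (T.bot T.winner))
    else T.bot
  len := Function.update T.len T.winner (T.len T.winner - T.len T.loser)

/-- `T(n) = 𝒱^n(T)`. -/
def iter [NeZero d] (T : IEM 𝒜 d) (n : ℕ) : IEM 𝒜 d := rauzy^[n] T

/-- `B_γ = 1 + E_{βα}` for the arrow `γ = γ(n, n+1)` with winner `α` and loser `β`. -/
def arrowMatrix [NeZero d] [DecidableEq 𝒜] (T : IEM 𝒜 d) (n : ℕ) : Matrix 𝒜 𝒜 ℤ :=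
  1 + Matrix.single (T.iter n).loser (T.iter n).winner 1

/-- The product `B_{γ(m+l-1, m+l)} ⋯ B_{γ(m, m+1)}` over the path of `l` arrows from `T(m)`. -/
def pathMatrix [NeZero d] [DecidableEq 𝒜] (T : IEM 𝒜 d) (m : ℕ) : ℕ → Matrix 𝒜 𝒜 ℤ
  | 0 => 1
  | l + 1 => T.arrowMatrix (m + l) * T.pathMatrix m l

/-- The cocycle matrix `B(m, n)`, for `m ≤ n`. -/
def B [NeZero d] [DecidableEq 𝒜] (T : IEM 𝒜 d) (m n : ℕ) : Matrix 𝒜 𝒜 ℤ :=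
  T.pathMatrix m (n - m)

/-- The Zorich times: `n_0 = 0`, and `n_{k+1} > n_k` is the largest integer such that
all the arrows in `γ(n_k, n_{k+1})` have the same winner. -/
def zorichTime [NeZero d] (T : IEM 𝒜 d) : ℕ → ℕ
  | 0 => 0
  | k + 1 => sSup {n | T.zorichTime k < n ∧
      ∃ α, ∀ i, T.zorichTime k ≤ i → i < n → (T.iter i).winner = α}

/-- The Marmi–Moussa–Yoccoz times: `m_0 = 0`, and `m_{k+1} > m_k` is the largest integer such that
not all letters are winners of arrows in `γ(m_k, m_{k+1})`. -/
def mmyTime [NeZero d] (T : IEM 𝒜 d) : ℕ → ℕ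
  | 0 => 0
  | k + 1 => sSup {n | T.mmyTime k < n ∧
      ∃ α, ∀ i, T.mmyTime k ≤ i → i < n → (T.iter i).winner ≠ α}

/-- The matrix norm `‖A‖ = ∑_{i,j} |a_{ij}|`. -/
def entryNorm (A : Matrix 𝒜 𝒜 ℤ) : ℝ := ∑ i, ∑ j, |(A i j : ℝ)|

/-! ### Discontinuities of the iterates -/

/-- The discontinuity points of `T^n` as an interval exchange map on `[0, λ^*)`: the points
`x` whose orbit `x, T x, …, T^{n-1} x` meets one of the separation points `p_β`, where `I_β` is not
the leftmost interval, together with the two endpoints `0` and `λ^*`. -/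
def discont (T : IEM 𝒜 d) (n : ℕ) : Set ℝ :=
  {0, T.total} ∪ {x | x ∈ Set.Ico 0 T.total ∧
    ∃ j < n, ∃ β, 0 < (T.top β : ℕ) ∧ T.map^[j] x = T.p β}

/-- `Δ(T^n)`, the minimal distance between two discontinuity points of `T^n`
(the infimum is taken over a non-empty finite set). -/
def gap (T : IEM 𝒜 d) (n : ℕ) : ℝ :=
  sInf {δ | ∃ x ∈ T.discont n, ∃ y ∈ T.discont n, x ≠ y ∧ δ = |x - y|}

/-! ### The bounded type conditions -/

/-- Condition (A) with the constant `M`. -/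
def MMYBoundedBy [NeZero d] [DecidableEq 𝒜] (T : IEM 𝒜 d) (M : ℝ) : Prop :=
  ∀ k, entryNorm (T.B (T.mmyTime k) (T.mmyTime (k + 1))) ≤ M

/-- Condition (Z) with the constant `M`. -/
def ZorichBoundedBy [NeZero d] [DecidableEq 𝒜] (T : IEM 𝒜 d) (M : ℝ) : Prop :=
  ∀ k, entryNorm (T.B (T.zorichTime k) (T.zorichTime (k + 1))) ≤ M

/-- Condition (D): there is `c > 0` with `Δ(T^n) ≥ c / n` for all `n ≥ 1`. -/
def CondD (T : IEM 𝒜 d) : Prop :=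
  ∃ c : ℝ, 0 < c ∧ ∀ n : ℕ, 1 ≤ n → c / n ≤ T.gap n

/-- Condition (U): there is `c > 0` with `liminf n |T^n x - x| ≥ c` for all `x ∈ [0, λ^*)`.
The lower limit is taken in the extended reals, where it always exists. -/
def CondU (T : IEM 𝒜 d) : Prop :=
  ∃ c : ℝ, 0 < c ∧ ∀ x ∈ Set.Ico 0 T.total,
    (c : EReal) ≤ liminf (fun n : ℕ => ((n * |T.map^[n] x - x| : ℝ) : EReal)) atTop

end IEM

end

/-!
For a Keane map all the Rauzy–Veech iterates `T(n)` exist, and `T(n)` is the first return map of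
`T` to `[0, λ^*(n))`, with a return time `height n α` which is constant on the interval `I_α(n)`
(`IsTower`, `Good.tower`). The floors `T^j(I_α(n))`, `j < height n α`, partition `[0, λ^*)`, and the
singularities `p_β` are left endpoints of floors. Lengths and return times are
transformed by the matrices `B(m, n)` and their transposes (`Good.len_eq`, `height_eq`).

Every letter wins infinitely often: otherwise the letters which do not would eventually occupy the
first places in both rows, against admissibility (`Good.frequently_winner`). When
the winner changes, the old winner loses the next arrow, so the support of a column of `B(m, n)`
grows whenever the winner enters this support. Counting Marmi–Moussa–Yoccoz times gives that
`B(m_k, m_{k+r})` is positive for `r = max (2d - 3) 2` (`Good.B_mmyTime_pos`). Positivity implies that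
`λ^*(n) → 0`, that the return times tend to infinity, and minimality.

*(A) implies (D).* Take the first `k` for which all return times at time `m_k` are at least `n`; by
(A) and positivity they are at most `M^{r+1} n`. At time `m_{k+r}` the interval is contained in
the first cell at time `m_k`, hence the discontinuities of `T^n` are left endpoints of
floors at time `m_{k+r}`. Their distances are at least the lengths at that time, and these
are at least `λ^*(m_{k+2r}) ≥ λ^* / (M^{2r} M^{r+1} n)`.

*(D) implies (U).* `T^n` translates a continuity interval by some `δ`. If `|δ|` is small, an endpoint
of the interval and its preimage are discontinuities of `T^{2n}` at distance `|δ|`; so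
`|T^n x - x| ≥ c / (2n)` for all `x` and `n` (`Good.div_le_displacement`).

*(D) implies (A).* Let `J` be a continuity interval of `T^n` and let `y ∈ J` not return to `J` up to
time `t`. The continuity intervals `K_s ∋ y` of `T^{s+n}` have length at least `c / (s + n)`, and
the `T^s(K_s)`, `s ≤ t`, are disjoint. So `∑_{s ≤ t} c / (s + n) ≤ λ^*`, whence `t ≤ C n`
(`Good.add_le_of_avoid`). This gives uniform visit times, hence return times to
`[0, λ^*(m))` comparable to `1 / λ^*(m)` (`Good.exists_height_mul_total_le`,
`Good.le_height_mul_total`). Between two consecutive Marmi–Moussa–Yoccoz times some letter does not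
win; its length does not change and is comparable to `λ^*(m_k)`. So `λ^*(m_{k+1})` is comparable to
`λ^*(m_k)`, the return times grow by a bounded factor, and the matrix is bounded.

*(U) implies (Z).* In a run of arrows with the same winner `α` the losers are subtracted cyclically
from `α`, so a long run means that the induced map moves most of `I_α` by a distance `δ` which
is short in comparison with `I_α`. On the tower over this part of `I_α`, of height `h`, one has
`h |T^h x - x| = h δ`, which is small. If the runs are unbounded, nested intervals produce
a point `x` at which the lower limit in (U) is zero.
-/

set_option linter.unusedSectionVars false

open Filter

noncomputable section

namespace IEM

variable {𝒜 : Type*} [Fintype 𝒜] {d : ℕ}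

/-! ### Intervals placed side by side -/

section Offset

/-- The left endpoint of the interval labelled `α` when intervals of lengths `len` are
placed side by side in the order given by `e`. -/
def offset (e : 𝒜 ≃ Fin d) (len : 𝒜 → ℝ) (α : 𝒜) : ℝ := ∑ β with e β < e α, len β

theorem p_eq_offset (T : IEM 𝒜 d) : T.p = offset T.top T.len := rfl

theorem q_eq_offset (T : IEM 𝒜 d) : T.q = offset T.bot T.len := rfl

variable {e : 𝒜 ≃ Fin d} {len : 𝒜 → ℝ}

theorem offset_nonneg (h : ∀ α, 0 < len α) (α : 𝒜) : 0 ≤ offset e len α :=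
  Finset.sum_nonneg fun _ _ => (h _).le

theorem offset_add_len (α : 𝒜) : offset e len α + len α = ∑ β with e β ≤ e α, len β := by
  classical
  have : (Finset.univ.filter fun β => e β ≤ e α) =
      insert α (Finset.univ.filter fun β => e β < e α) := by
    ext β
    simp only [Finset.mem_filter, Finset.mem_univ, true_and, Finset.mem_insert]
    rw [le_iff_eq_or_lt, e.injective.eq_iff]
  rw [this, Finset.sum_insert (by simp), add_comm]
  rfl

theorem offset_add_len_le (h : ∀ α, 0 < len α) {α β : 𝒜} (hαβ : e α < e β) :
    offset e len α + len α ≤ offset e len β := by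
  rw [offset_add_len]
  refine Finset.sum_le_sum_of_subset_of_nonneg ?_ fun _ _ _ => (h _).le
  intro γ
  simp only [Finset.mem_filter, Finset.mem_univ, true_and]
  exact fun hγ => hγ.trans_lt hαβ

theorem offset_add_len_le_sum (h : ∀ α, 0 < len α) (α : 𝒜) :
    offset e len α + len α ≤ ∑ β, len β := by
  rw [offset_add_len]
  exact Finset.sum_le_sum_of_subset_of_nonneg (Finset.filter_subset _ _) fun _ _ _ => (h _).le

theorem offset_next {α β : 𝒜} (h : (e β : ℕ) = e α + 1) :
    offset e len β = offset e len α + len α := by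
  rw [offset_add_len, offset]
  refine Finset.sum_congr ?_ fun _ _ => rfl
  ext γ
  simp only [Finset.mem_filter, Finset.mem_univ, true_and]
  rw [Fin.lt_def, Fin.le_def]
  omega

theorem offset_add_len_last {α : 𝒜} (h : (e α : ℕ) + 1 = d) :
    offset e len α + len α = ∑ β, len β := by
  rw [offset_add_len]
  refine Finset.sum_congr ?_ fun _ _ => rfl
  ext γ
  simp only [Finset.mem_filter, Finset.mem_univ, true_and, iff_true]
  rw [Fin.le_def]
  have := (e γ).isLt
  omega

theorem offset_first {α : 𝒜} (h : (e α : ℕ) = 0) : offset e len α = 0 := by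
  refine Finset.sum_eq_zero fun γ hγ => ?_
  simp only [Finset.mem_filter, Finset.mem_univ, true_and] at hγ
  rw [Fin.lt_def] at hγ
  omega

theorem offset_pos (h : ∀ α, 0 < len α) {α : 𝒜} (hα : 0 < (e α : ℕ)) :
    0 < offset e len α := by
  have hlt : e (e.symm ⟨0, by omega⟩) < e α := by
    rw [Fin.lt_def]; simpa using hα
  have := offset_add_len_le h hlt
  have := offset_nonneg (e := e) h (e.symm ⟨0, by omega⟩)
  have := h (e.symm ⟨0, by omega⟩)
  linarith

theorem offset_pos_iff (h : ∀ α, 0 < len α) {α : 𝒜} :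
    0 < offset e len α ↔ 0 < (e α : ℕ) := by
  refine ⟨fun hα => ?_, offset_pos h⟩
  by_contra h0
  rw [offset_first (by omega)] at hα
  exact lt_irrefl _ hα

theorem eq_of_mem_offset (h : ∀ α, 0 < len α) {α β : 𝒜} {x : ℝ}
    (hα : x ∈ Set.Ico (offset e len α) (offset e len α + len α))
    (hβ : x ∈ Set.Ico (offset e len β) (offset e len β + len β)) : α = β := by
  rcases lt_trichotomy (e α) (e β) with hlt | heq | hlt
  · have := offset_add_len_le h hlt
    have := hα.2
    have := hβ.1
    linarith
  · exact e.injective heq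
  · have := offset_add_len_le h hlt
    have := hβ.2
    have := hα.1
    linarith

theorem exists_mem_offset {x : ℝ} (hx : x ∈ Set.Ico 0 (∑ α, len α)) :
    ∃ α, x ∈ Set.Ico (offset e len α) (offset e len α + len α) := by
  by_contra hcon
  push Not at hcon
  have key : ∀ n : ℕ, ∀ α, (e α : ℕ) = n → offset e len α ≤ x := by
    intro n
    induction n with
    | zero => intro α hα; rw [offset_first hα]; exact hx.1
    | succ n ih =>
      intro α hα
      have hlt : n < d := by have := (e α).isLt; omega
      have h1 := ih (e.symm ⟨n, hlt⟩) (by simp)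
      rw [offset_next (α := e.symm ⟨n, hlt⟩) (by simp [hα])]
      by_contra h2
      exact hcon _ ⟨h1, not_le.mp h2⟩
  rcases Nat.eq_zero_or_pos d with rfl | hd
  · have : IsEmpty 𝒜 := e.isEmpty
    simp at hx
  · have h1 := key (d - 1) (e.symm ⟨d - 1, by omega⟩) (by simp)
    refine hcon _ ⟨h1, ?_⟩
    rw [offset_add_len_last (by simp; omega)]
    exact hx.2

end Offset

/-! ### The cells and the map -/

section Cells

/-- The interval `I_α = [p_α, p_α + λ_α)`. -/
def cell (T : IEM 𝒜 d) (α : 𝒜) : Set ℝ := Set.Ico (T.p α) (T.p α + T.len α)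

variable {T : IEM 𝒜 d}

theorem p_mem_cell (hT : T.Positive) (α : 𝒜) : T.p α ∈ T.cell α :=
  ⟨le_rfl, by have := hT α; linarith⟩

theorem cell_subset (hT : T.Positive) (α : 𝒜) : T.cell α ⊆ Set.Ico 0 T.total := fun _ hx =>
  ⟨(offset_nonneg hT α).trans hx.1, hx.2.trans_le (offset_add_len_le_sum hT α)⟩

theorem eq_of_mem_cell (hT : T.Positive) {α β : 𝒜} {x : ℝ} (hα : x ∈ T.cell α)
    (hβ : x ∈ T.cell β) : α = β := eq_of_mem_offset hT hα hβ

theorem exists_mem_cell {x : ℝ} (hx : x ∈ Set.Ico 0 T.total) :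
    ∃ α, x ∈ T.cell α := exists_mem_offset hx

theorem map_of_mem_cell (hT : T.Positive) {α : 𝒜} {x : ℝ} (hx : x ∈ T.cell α) :
    T.map x = x - T.p α + T.q α := by
  rw [map, Finset.sum_eq_single α]
  · rw [Set.indicator_of_mem (show x ∈ Set.Ico _ _ from hx)]; ring
  · intro β _ hβ
    exact Set.indicator_of_notMem (fun h => hβ (eq_of_mem_cell hT h hx)) _
  · intro h; exact absurd (Finset.mem_univ _) h

theorem map_mem_image_cell (hT : T.Positive) {α : 𝒜} {x : ℝ} (hx : x ∈ T.cell α) :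
    T.map x ∈ Set.Ico (T.q α) (T.q α + T.len α) := by
  rw [map_of_mem_cell hT hx]
  exact ⟨by linarith [hx.1], by linarith [hx.2]⟩

theorem map_mem (hT : T.Positive) {x : ℝ} (hx : x ∈ Set.Ico 0 T.total) :
    T.map x ∈ Set.Ico 0 T.total := by
  obtain ⟨α, hα⟩ := exists_mem_cell hx
  have h := map_mem_image_cell hT hα
  exact ⟨(offset_nonneg hT α).trans h.1, h.2.trans_le (offset_add_len_le_sum hT α)⟩

theorem map_injOn (hT : T.Positive) : Set.InjOn T.map (Set.Ico 0 T.total) := by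
  intro x hx y hy hxy
  obtain ⟨α, hα⟩ := exists_mem_cell hx
  obtain ⟨β, hβ⟩ := exists_mem_cell hy
  have h1 := map_mem_image_cell hT hα
  have h2 := map_mem_image_cell hT hβ
  rw [← hxy] at h2
  obtain rfl : α = β := eq_of_mem_offset hT h1 h2
  rw [map_of_mem_cell hT hα, map_of_mem_cell hT hβ] at hxy
  linarith

theorem exists_map_eq (hT : T.Positive) {y : ℝ} (hy : y ∈ Set.Ico 0 T.total) :
    ∃ x ∈ Set.Ico 0 T.total, T.map x = y := by
  obtain ⟨α, hα⟩ := exists_mem_offset (e := T.bot) hy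
  have hx : y - T.q α + T.p α ∈ T.cell α :=
    ⟨by have := hα.1; rw [q_eq_offset]; linarith, by have := hα.2; rw [q_eq_offset]; linarith⟩
  exact ⟨_, cell_subset hT α hx, by rw [map_of_mem_cell hT hx]; ring⟩

theorem iterate_mem (hT : T.Positive) {x : ℝ} (hx : x ∈ Set.Ico 0 T.total) (n : ℕ) :
    T.map^[n] x ∈ Set.Ico 0 T.total :=
  Set.MapsTo.iterate (f := T.map) (fun _ h => map_mem hT h) n hx

theorem iterate_injOn (hT : T.Positive) (n : ℕ) :
    Set.InjOn T.map^[n] (Set.Ico 0 T.total) :=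
  (map_injOn hT).iterate (fun _ h => map_mem hT h) n

theorem exists_iterate_eq (hT : T.Positive) (n : ℕ) {y : ℝ} (hy : y ∈ Set.Ico 0 T.total) :
    ∃ x ∈ Set.Ico 0 T.total, T.map^[n] x = y := by
  induction n with
  | zero => exact ⟨y, hy, rfl⟩
  | succ n ih =>
    obtain ⟨x, hx, rfl⟩ := ih
    obtain ⟨z, hz, rfl⟩ := exists_map_eq hT hx
    exact ⟨z, hz, Function.iterate_succ_apply _ _ _⟩

theorem p_mem (hT : T.Positive) (α : 𝒜) : T.p α ∈ Set.Ico 0 T.total :=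
  cell_subset hT α (p_mem_cell hT α)

theorem p_pos_iff (hT : T.Positive) {α : 𝒜} : 0 < T.p α ↔ 0 < (T.top α : ℕ) :=
  offset_pos_iff hT

theorem total_pos [NeZero d] (hT : T.Positive) : 0 < T.total :=
  Finset.sum_pos (fun _ _ => hT _) ⟨T.top.symm ⊤, Finset.mem_univ _⟩

theorem exists_p_eq_zero [NeZero d] (T : IEM 𝒜 d) :
    ∃ α, T.p α = 0 :=
  ⟨T.top.symm 0, offset_first (by simp)⟩

theorem iterate_p_ne (hT : T.Positive) (hK : T.Keane) {α β : 𝒜} {m : ℕ} (hm : 1 ≤ m)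
    (hβ : 0 < T.p β) : T.map^[m] (T.p α) ≠ T.p β := fun h =>
  hK ⟨α, β, m, hm, (p_pos_iff hT).mp hβ, h⟩

theorem iterate_zero_ne [NeZero d] (hT : T.Positive) (hK : T.Keane) {β : 𝒜} (m : ℕ)
    (hβ : 0 < T.p β) : T.map^[m] 0 ≠ T.p β := by
  obtain ⟨α, hα⟩ := T.exists_p_eq_zero
  rcases Nat.eq_zero_or_pos m with rfl | hm
  · simpa using hβ.ne
  · rw [← hα]; exact iterate_p_ne hT hK hm hβ

theorem eq_of_p_mem_cell (hT : T.Positive) {α β : 𝒜} (h : T.p β ∈ T.cell α) : β = α :=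
  eq_of_mem_cell hT (p_mem_cell hT β) h

end Cells

/-! ### The effect of moving a letter on a row -/

theorem lt_top_iff_val [NeZero d] {i : Fin d} : i < ⊤ ↔ (i : ℕ) + 1 < d := by
  have h : ((⊤ : Fin d) : ℕ) + 1 = d := by
    have h1 : (⟨d - 1, by have := NeZero.pos d; omega⟩ : Fin d) ≤ ⊤ := le_top
    rw [Fin.le_def] at h1
    have := (⊤ : Fin d).isLt
    simp only at h1
    omega
  rw [Fin.lt_def]
  omega

theorem val_top [NeZero d] : ((⊤ : Fin d) : ℕ) + 1 = d := by
  have h1 := (lt_top_iff_val (i := (⊤ : Fin d))).not.mp (lt_irrefl _)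
  have := (⊤ : Fin d).isLt
  omega

section Rows

variable {ι : Type*} [NeZero d] {e : ι ≃ Fin d}

theorem lt_top_of_ne {w l : ι} (hl : e l = ⊤) (hne : w ≠ l) : e w < ⊤ :=
  lt_of_le_of_ne le_top fun h => hne (e.injective (h.trans hl.symm))

theorem insertAfter_of_le {w l : ι} (hl : e l = ⊤) (hne : w ≠ l) {x : ι} (hx : e x ≤ e w) :
    ((e.trans (insertAfter (e w))) x : ℕ) = e x := by
  rw [Equiv.trans_apply, insertAfter_apply _ _ (lt_top_of_ne hl hne), if_pos hx]

theorem insertAfter_of_lt {w l : ι} (hl : e l = ⊤) (hne : w ≠ l) {x : ι} (hx : e w < e x)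
    (hxl : x ≠ l) : ((e.trans (insertAfter (e w))) x : ℕ) = e x + 1 := by
  rw [Equiv.trans_apply, insertAfter_apply _ _ (lt_top_of_ne hl hne), if_neg hx.not_ge,
    if_neg (lt_top_of_ne hl hxl).ne]

theorem insertAfter_last {w l : ι} (hl : e l = ⊤) (hne : w ≠ l) :
    ((e.trans (insertAfter (e w))) l : ℕ) = e w + 1 := by
  rw [Equiv.trans_apply, insertAfter_apply _ _ (lt_top_of_ne hl hne), if_neg, if_pos hl]
  rw [hl]
  exact (lt_top_of_ne hl hne).not_ge

/-- Moving the last letter of a row just after `w` does not affect the initial segments of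
the row which do not contain `w`. -/
theorem insertAfter_lt_iff {w l : ι} (hl : e l = ⊤) (hne : w ≠ l) {k : ℕ} (hk : k ≤ e w) (x : ι) :
    ((e.trans (insertAfter (e w))) x : ℕ) < k ↔ (e x : ℕ) < k := by
  by_cases hx : e x ≤ e w
  · rw [insertAfter_of_le hl hne hx]
  · have h1 := Fin.lt_def.mp (not_le.mp hx)
    by_cases hxl : x = l
    · subst hxl; rw [insertAfter_last hl hne]; omega
    · rw [insertAfter_of_lt hl hne (not_le.mp hx) hxl]; omega

variable [Fintype ι] [DecidableEq ι]

/-- The offsets do not see a change of the length of the last interval. -/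
theorem offset_update_last {w : ι} (hw : e w = ⊤) (len : ι → ℝ) (c : ℝ) :
    offset e (Function.update len w c) = offset e len := by
  funext x
  refine Finset.sum_congr rfl fun β hβ => Function.update_of_ne ?_ _ _
  rintro rfl
  simp only [Finset.mem_filter, Finset.mem_univ, true_and, hw] at hβ
  exact (le_top.not_gt) hβ

/-- The effect of a Rauzy–Veech step on the offsets in the row which changes: only the
loser is moved, to the right end of what remains of the interval of the winner. -/
theorem offset_move {w l : ι} (hl : e l = ⊤) (hne : w ≠ l) (len : ι → ℝ) (x : ι) :
    offset (e.trans (insertAfter (e w))) (Function.update len w (len w - len l)) x =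
      if x = l then offset e len w + len w - len l else offset e len x := by
  have hwt := lt_top_iff_val.mp (lt_top_of_ne hl hne)
  have hlt : (e l : ℕ) + 1 = d := by rw [hl, val_top]
  have hval : ∀ y, ((e.trans (insertAfter (e w))) y : ℕ) =
      if y = l then (e w : ℕ) + 1 else if (e y : ℕ) ≤ e w then (e y : ℕ) else e y + 1 := by
    intro y
    split_ifs with h1 h2
    · rw [h1, insertAfter_last hl hne]
    · exact insertAfter_of_le hl hne h2
    · exact insertAfter_of_lt hl hne (Fin.lt_def.mpr (not_le.mp h2)) h1
  have hupd : ∀ y, Function.update len w (len w - len l) y =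
      len y + if y = w then - len l else 0 := by
    intro y
    by_cases h : y = w
    · subst h; simp; ring
    · simp [h]
  simp only [offset, Finset.sum_filter, Fin.lt_def, hval, hupd]
  have hinj : ∀ y, (e y : ℕ) = e w → y = w := fun y h => e.injective (Fin.ext h)
  have hlast : ∀ y, y ≠ l → (e y : ℕ) + 1 < d := fun y hy =>
    lt_top_iff_val.mp (lt_top_of_ne hl hy)
  by_cases hx : x = l
  · subst hx
    have hL : offset e len w + len w - len x =
        ∑ y, (if (e y : ℕ) ≤ e w then len y else 0) + ∑ y, if y = w then -len x else 0 := by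
      rw [offset_add_len, Finset.sum_filter, Finset.sum_ite_eq' Finset.univ w]
      simp only [Finset.mem_univ, if_true, Fin.le_def]
      ring
    simp only [if_true]
    have hL' := hL
    simp only [offset, Finset.sum_filter, Fin.lt_def] at hL'
    rw [hL', ← Finset.sum_add_distrib]
    refine Finset.sum_congr rfl fun y _ => ?_
    by_cases hyl : y = x
    · subst hyl
      have : ¬ ((e y : ℕ) ≤ e w) := by omega
      simp [this, hne.symm]
    · by_cases hyw : y = w
      · subst hyw; simp [hyl]
      · have : ¬ (e y : ℕ) = e w := fun h => hyw (hinj y h)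
        simp only [hyl, hyw, if_false]
        split_ifs <;> first | omega | simp
  · -- If the loser is now before `x`, it makes up for the loss of the winner.
    have hL : ∑ y : ι, (if (e y : ℕ) < e x then len y else (0 : ℝ)) =
        ∑ y : ι, ((if (e y : ℕ) < e x then len y else 0) + ((if y = l then
          (if (e w : ℕ) < e x then len l else 0) else 0) +
          (if y = w then (if (e w : ℕ) < e x then - len l else 0) else 0))) := by
      rw [Finset.sum_add_distrib, Finset.sum_add_distrib, Finset.sum_ite_eq' Finset.univ w,
        Finset.sum_ite_eq' Finset.univ l]
      simp only [Finset.mem_univ, if_true]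
      split_ifs <;> ring
    simp only [hx, if_false]
    rw [hL]
    refine Finset.sum_congr rfl fun y _ => ?_
    have hx' := hlast x hx
    by_cases hyl : y = l
    · subst hyl
      have h2 : ¬ ((e y : ℕ) < e x) := by omega
      simp only [if_true, if_false, h2, hne.symm]
      split_ifs <;> first | omega | simp
    · by_cases hyw : y = w
      · subst hyw
        simp only [if_true, if_false, hyl]
        split_ifs <;> first | omega | simp
      · have : ¬ (e y : ℕ) = e w := fun h => hyw (hinj y h)
        simp only [hyl, hyw, if_false]
        split_ifs <;> first | omega | simp

end Rows

/-! ### One step of the Rauzy–Veech algorithm -/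

section OneStep

variable [NeZero d] {S : IEM 𝒜 d}

theorem top_lastTop : S.top S.lastTop = ⊤ := by simp [lastTop]

theorem bot_lastBot : S.bot S.lastBot = ⊤ := by simp [lastBot]

theorem Admissible.lastTop_ne_lastBot (hd : 2 ≤ d) (hS : S.Admissible) :
    S.lastTop ≠ S.lastBot := by
  intro h
  refine hS (d - 1) (by omega) (by omega) (Set.ext fun α => ?_)
  have h1 : (S.top α : ℕ) < d - 1 ↔ α ≠ S.lastTop := by
    rw [← (S.top.injective.ne_iff), top_lastTop, ← lt_top_iff_ne_top, lt_top_iff_val]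
    omega
  have h2 : (S.bot α : ℕ) < d - 1 ↔ α ≠ S.lastBot := by
    rw [← (S.bot.injective.ne_iff), bot_lastBot, ← lt_top_iff_ne_top, lt_top_iff_val]
    omega
  simp only [Set.mem_ofPred_eq, h1, h2, h]

/-- Relation between an interval exchange map `S` and the map `S'` which it induces on a
shorter interval, when the return time is `1` except on the cell of the letter `l`, where
it is `2`: the points of this cell start in the `S`-cell of `a` and pass through that of `b`.
Both cases of one Rauzy–Veech step with winner `w` and loser `l` are of this form. -/
structure IsInducedStep (S S' : IEM 𝒜 d) (w l a b : 𝒜) : Prop where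
  pair : (a = w ∧ b = l) ∨ (a = l ∧ b = w)
  ne : w ≠ l
  len_loser : S'.len l = S.len l
  p_of_ne : ∀ γ, γ ≠ l → S'.p γ = S.p γ
  cell_of_ne : ∀ γ, γ ≠ l → S'.cell γ ⊆ S.cell γ
  map_of_ne : ∀ γ, γ ≠ l → ∀ x ∈ S'.cell γ, S'.map x = S.map x
  cell_loser : S'.cell l ⊆ S.cell a
  map_loser : ∀ x ∈ S'.cell l, S.map x ∈ S.cell b ∧ S'.total ≤ S.map x ∧
    S'.map x = S.map (S.map x)
  total_eq : S'.total = S.total - S.len l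
  surj : ∀ y ∈ Set.Ico S'.total S.total, y ∈ S.cell b ∧ ∃ x ∈ S'.cell l, S.map x = y
  p_loser : S'.p l = S.p l ∨ (a = w ∧ S.map (S'.p l) = S.p l)

theorem winner_ne_loser (hne : S.lastTop ≠ S.lastBot) : S.winner ≠ S.loser := by
  unfold winner loser
  split_ifs
  · exact hne
  · exact hne.symm

theorem rauzy_len [DecidableEq 𝒜] : S.rauzy.len =
    Function.update S.len S.winner (S.len S.winner - S.len S.loser) := by
  unfold rauzy
  simp only
  congr
  exact Subsingleton.elim _ _

theorem rauzy_len_winner : S.rauzy.len S.winner = S.len S.winner - S.len S.loser := by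
  classical
  rw [rauzy_len, Function.update_self]

theorem rauzy_len_of_ne {γ : 𝒜} (h : γ ≠ S.winner) : S.rauzy.len γ = S.len γ := by
  classical
  rw [rauzy_len, Function.update_of_ne h]

theorem rauzy_total : S.rauzy.total = S.total - S.len S.loser := by
  classical
  have h : ∀ y, S.rauzy.len y = S.len y + if y = S.winner then - S.len S.loser else 0 := by
    intro y
    by_cases h : y = S.winner
    · subst h; rw [rauzy_len_winner, if_pos rfl]; ring
    · rw [rauzy_len_of_ne h, if_neg h, add_zero]
  unfold total
  rw [Finset.sum_congr rfl fun y _ => h y, Finset.sum_add_distrib]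
  simp
  ring

theorem len_loser_lt_winner (hlen : S.len S.lastTop ≠ S.len S.lastBot) :
    S.len S.loser < S.len S.winner := by
  unfold winner loser
  split_ifs with h
  · exact lt_of_le_of_ne h hlen.symm
  · exact not_le.mp h

theorem rauzy_positive (hS : S.Positive) (hlen : S.len S.lastTop ≠ S.len S.lastBot) :
    S.rauzy.Positive := by
  intro γ
  by_cases h : γ = S.winner
  · subst h; rw [rauzy_len_winner]; linarith [len_loser_lt_winner hlen]
  · rw [rauzy_len_of_ne h]; exact hS γ

/-- The type of a Rauzy–Veech step: the winner is last in the top row and the bottom row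
changes, or the other way round. -/
theorem rauzy_cases (S : IEM 𝒜 d) :
    (S.winner = S.lastTop ∧ S.loser = S.lastBot ∧ S.rauzy.top = S.top ∧
      S.rauzy.bot = S.bot.trans (insertAfter (S.bot S.winner))) ∨
    (S.winner = S.lastBot ∧ S.loser = S.lastTop ∧ S.rauzy.bot = S.bot ∧
      S.rauzy.top = S.top.trans (insertAfter (S.top S.winner))) := by
  by_cases h : S.len S.lastBot ≤ S.len S.lastTop
  · left; simp [winner, loser, rauzy, h]
  · right; simp [winner, loser, rauzy, h]

theorem rauzy_admissible (hS : S.Admissible) (hne : S.lastTop ≠ S.lastBot) :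
    S.rauzy.Admissible := by
  have hwl := winner_ne_loser hne
  intro k hk hkd heq
  rcases rauzy_cases S with ⟨hw, hl, ht, hb⟩ | ⟨hw, hl, hb, ht⟩
  · have hl' : S.bot S.loser = ⊤ := by rw [hl, bot_lastBot]
    have hw' : (S.top S.winner : ℕ) + 1 = d := by rw [hw, top_lastTop, val_top]
    have hk' : k ≤ S.bot S.winner := by
      have h1 : S.winner ∉ {α | (S.rauzy.top α : ℕ) < k} := by
        rw [ht, Set.mem_ofPred_eq]; omega
      rw [heq, hb, Set.mem_ofPred_eq, insertAfter_of_le hl' hwl le_rfl] at h1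
      omega
    refine hS k hk hkd ?_
    rw [ht, hb] at heq
    rw [heq]
    ext x
    exact insertAfter_lt_iff hl' hwl hk' x
  · have hl' : S.top S.loser = ⊤ := by rw [hl, top_lastTop]
    have hw' : (S.bot S.winner : ℕ) + 1 = d := by rw [hw, bot_lastBot, val_top]
    have hk' : k ≤ S.top S.winner := by
      have h1 : S.winner ∉ {α | (S.rauzy.bot α : ℕ) < k} := by
        rw [hb, Set.mem_ofPred_eq]; omega
      rw [← heq, ht, Set.mem_ofPred_eq, insertAfter_of_le hl' hwl le_rfl] at h1
      omega
    refine hS k hk hkd ?_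
    rw [ht, hb] at heq
    rw [← heq]
    ext x
    exact (insertAfter_lt_iff hl' hwl hk' x).symm

theorem p_lastTop : S.p S.lastTop + S.len S.lastTop = S.total :=
  offset_add_len_last (by rw [top_lastTop, val_top])

theorem q_lastBot : S.q S.lastBot + S.len S.lastBot = S.total :=
  offset_add_len_last (by rw [bot_lastBot, val_top])

/-- In a step of top type the points of the cell of the loser first visit this cell and then that of
the winner; in a step of bottom type it is the other way round. -/
theorem exists_isInducedStep (hS : S.Positive) (hne : S.lastTop ≠ S.lastBot)
    (hlen : S.len S.lastTop ≠ S.len S.lastBot) :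
    ∃ a b, IsInducedStep S S.rauzy S.winner S.loser a b := by
  classical
  have hwl := winner_ne_loser hne
  have hlt := len_loser_lt_winner hlen
  have hS' := rauzy_positive hS hlen
  have hle : ∀ γ, S.rauzy.len γ ≤ S.len γ := by
    intro γ
    by_cases h : γ = S.winner
    · subst h; rw [rauzy_len_winner]; linarith [hS S.loser]
    · rw [rauzy_len_of_ne h]
  have hlen_l : S.rauzy.len S.loser = S.len S.loser := rauzy_len_of_ne hwl.symm
  have hcell : ∀ γ, S.rauzy.p γ = S.p γ → S.rauzy.cell γ ⊆ S.cell γ := fun γ h x hx =>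
    ⟨h ▸ hx.1, by have := hx.2; have := hle γ; rw [h] at *; linarith⟩
  have hmap : ∀ γ, S.rauzy.p γ = S.p γ → S.rauzy.q γ = S.q γ → ∀ x ∈ S.rauzy.cell γ,
      S.rauzy.map x = S.map x := fun γ h1 h2 x hx => by
    rw [map_of_mem_cell hS' hx, map_of_mem_cell hS (hcell γ h1 hx), h1, h2]
  have htot := rauzy_total (S := S)
  have hlpos := hS S.loser
  rcases rauzy_cases S with ⟨hw, hl, ht, hb⟩ | ⟨hw, hl, hb, ht⟩
  · have hwtop : S.top S.winner = ⊤ := by rw [hw, top_lastTop]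
    have hlbot : S.bot S.loser = ⊤ := by rw [hl, bot_lastBot]
    have hp : ∀ γ, S.rauzy.p γ = S.p γ := by
      intro γ
      rw [p_eq_offset, p_eq_offset, ht, rauzy_len, offset_update_last hwtop]
    have hq : ∀ γ, S.rauzy.q γ =
        if γ = S.loser then S.q S.winner + S.len S.winner - S.len S.loser else S.q γ := by
      intro γ
      rw [q_eq_offset, hb, rauzy_len, offset_move hlbot hwl]
      rfl
    have hpw : S.p S.winner + S.len S.winner = S.total := by rw [hw]; exact p_lastTop
    have hql : S.q S.loser + S.len S.loser = S.total := by rw [hl]; exact q_lastBot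
    have hq_ne : ∀ γ, γ ≠ S.loser → S.rauzy.q γ = S.q γ := fun γ h => by rw [hq, if_neg h]
    have hb' : ∀ y ∈ Set.Ico S.rauzy.total S.total, y ∈ S.cell S.winner := fun y hy =>
      ⟨by linarith [hy.1], by linarith [hy.2]⟩
    have hcl := hcell S.loser (hp _)
    refine ⟨S.loser, S.winner, Or.inr ⟨rfl, rfl⟩, hwl, hlen_l, fun γ _ => hp γ,
      fun γ _ => hcell γ (hp γ),
      fun γ h x hx => hmap γ (hp γ) (hq_ne γ h) x hx, hcl, ?_, htot, ?_, Or.inl (hp _)⟩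
    · intro x hx
      have h1 := map_of_mem_cell hS (hcl hx)
      have hx1 := (hcl hx).1
      have hx2 := (hcl hx).2
      have h2 : S.map x ∈ S.cell S.winner :=
        hb' _ ⟨by rw [h1]; linarith, by rw [h1]; linarith⟩
      refine ⟨h2, by rw [h1]; linarith, ?_⟩
      rw [map_of_mem_cell hS h2, h1, map_of_mem_cell hS' hx, hp, hq, if_pos rfl]
      linarith
    · intro y hy
      refine ⟨hb' y hy, y - S.q S.loser + S.p S.loser, ?_, ?_⟩
      · exact ⟨by rw [hp]; linarith [hy.1], by rw [hp, hlen_l]; linarith [hy.2]⟩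
      · rw [map_of_mem_cell hS (α := S.loser) ⟨by linarith [hy.1], by linarith [hy.2]⟩]
        ring
  · have hwbot : S.bot S.winner = ⊤ := by rw [hw, bot_lastBot]
    have hltop : S.top S.loser = ⊤ := by rw [hl, top_lastTop]
    have hq : ∀ γ, S.rauzy.q γ = S.q γ := by
      intro γ
      rw [q_eq_offset, q_eq_offset, hb, rauzy_len, offset_update_last hwbot]
    have hp : ∀ γ, S.rauzy.p γ =
        if γ = S.loser then S.p S.winner + S.len S.winner - S.len S.loser else S.p γ := by
      intro γ
      rw [p_eq_offset, ht, rauzy_len, offset_move hltop hwl]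
      rfl
    have hqw : S.q S.winner + S.len S.winner = S.total := by rw [hw]; exact q_lastBot
    have hpl : S.p S.loser + S.len S.loser = S.total := by rw [hl]; exact p_lastTop
    have hp_ne : ∀ γ, γ ≠ S.loser → S.rauzy.p γ = S.p γ := fun γ h => by rw [hp, if_neg h]
    have hp_l : S.rauzy.p S.loser = S.p S.winner + S.len S.winner - S.len S.loser := by
      rw [hp, if_pos rfl]
    have hb' : ∀ y ∈ Set.Ico S.rauzy.total S.total, y ∈ S.cell S.loser := fun y hy =>
      ⟨by linarith [hy.1], by linarith [hy.2]⟩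
    have hcl : S.rauzy.cell S.loser ⊆ S.cell S.winner := fun x hx => by
      have h1 := hx.1
      have h2 := hx.2
      rw [hp_l] at h1 h2
      rw [hlen_l] at h2
      exact ⟨by linarith, by linarith⟩
    have hm : ∀ x ∈ S.rauzy.cell S.loser, S.map x = x - S.rauzy.p S.loser + S.p S.loser :=
      fun x hx => by rw [map_of_mem_cell hS (hcl hx), hp_l]; linarith
    refine ⟨S.winner, S.loser, Or.inl ⟨rfl, rfl⟩, hwl, hlen_l, hp_ne,
      fun γ h => hcell γ (hp_ne γ h),
      fun γ h x hx => hmap γ (hp_ne γ h) (hq γ) x hx, hcl, ?_, htot, ?_, Or.inr ⟨rfl, ?_⟩⟩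
    · intro x hx
      have h1 := hm x hx
      have hx1 := hx.1
      have hx2 := hx.2
      rw [hlen_l] at hx2
      have h2 : S.map x ∈ S.cell S.loser :=
        hb' _ ⟨by rw [h1]; linarith, by rw [h1]; linarith⟩
      refine ⟨h2, by rw [h1]; linarith, ?_⟩
      rw [map_of_mem_cell hS h2, h1, map_of_mem_cell hS' hx, hq]
      linarith
    · intro y hy
      have hx : y - S.p S.loser + S.rauzy.p S.loser ∈ S.rauzy.cell S.loser :=
        ⟨by linarith [hy.1], by rw [hlen_l]; linarith [hy.2]⟩
      exact ⟨hb' y hy, _, hx, by rw [hm _ hx]; ring⟩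
    · rw [hm _ (p_mem_cell hS' _)]; ring

theorem IsInducedStep.cell_eq {S' : IEM 𝒜 d} {w l a b : 𝒜} (h : IsInducedStep S S' w l a b)
    (hS : S.Positive) {γ γ' : 𝒜} {x : ℝ} (hx : x ∈ S.cell γ) (hx' : x ∈ S'.cell γ') :
    γ' = γ ∨ (γ' = l ∧ γ = a) := by
  by_cases hl : γ' = l
  · subst hl
    exact Or.inr ⟨rfl, eq_of_mem_cell hS hx (h.cell_loser hx')⟩
  · exact Or.inl (eq_of_mem_cell hS (h.cell_of_ne γ' hl hx') hx)

end OneStep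

/-! ### Rokhlin towers of the induced maps -/

section Towers

/-- `S` is the first return map of `T` to `[0, λ^*(S))`, with the constant return time `h α` on
the cell of `α`, in such a way that the floors `T^j(I_α)`, `j < h α`, of the Rokhlin towers lie in
cells of `T`, cover the whole interval, and every tower contains a singularity of `T`
among the left endpoints of its floors (a genuine one if the base does not start at `0`). -/
structure IsTower (T S : IEM 𝒜 d) (h : 𝒜 → ℕ) : Prop where
  pos : ∀ α, 0 < h α
  total_le : S.total ≤ T.total
  ret : ∀ α, ∀ x ∈ S.cell α, T.map^[h α] x = S.map x
  le_iterate : ∀ α, ∀ x ∈ S.cell α, ∀ j, 0 < j → j < h α → S.total ≤ T.map^[j] x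
  floor : ∀ α, ∀ j < h α, ∃ β, ∀ x ∈ S.cell α, T.map^[j] x ∈ T.cell β
  cover : ∀ x ∈ Set.Ico 0 T.total, ∃ α, ∃ j < h α, ∃ y ∈ S.cell α, T.map^[j] y = x
  sing : ∀ α, ∃ j < h α, ∃ β, T.map^[j] (S.p α) = T.p β ∧ (0 < S.p α → 0 < T.p β)

variable {T S : IEM 𝒜 d} {h : 𝒜 → ℕ}

theorem isTower_self (T : IEM 𝒜 d) : IsTower T T fun _ => 1 where
  pos _ := one_pos
  total_le := le_rfl
  ret _ _ _ := rfl
  le_iterate _ _ _ j h0 h1 := by omega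
  floor α j hj := ⟨α, fun x hx => by obtain rfl : j = 0 := by omega
                                     exact hx⟩
  cover x hx := by
    obtain ⟨α, hα⟩ := exists_mem_cell hx
    exact ⟨α, 0, one_pos, x, hα, rfl⟩
  sing α := ⟨0, one_pos, α, rfl, id⟩

namespace IsTower

theorem mem_total (hh : IsTower T S h) {x : ℝ} (hx : x ∈ Set.Ico 0 S.total) :
    x ∈ Set.Ico 0 T.total := ⟨hx.1, hx.2.trans_le hh.total_le⟩

theorem iterate_sub (hT : T.Positive) (hh : IsTower T S h) {α : 𝒜} {x y : ℝ} (hx : x ∈ S.cell α)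
    (hy : y ∈ S.cell α) {j : ℕ} (hj : j ≤ h α) :
    T.map^[j] x - T.map^[j] y = x - y := by
  induction j with
  | zero => rfl
  | succ j ih =>
    obtain ⟨β, hβ⟩ := hh.floor α j hj
    rw [Function.iterate_succ_apply', Function.iterate_succ_apply',
      map_of_mem_cell hT (hβ x hx), map_of_mem_cell hT (hβ y hy), ← ih (by omega)]
    ring

/-- The floors of the towers are pairwise disjoint. -/
theorem floor_unique (hT : T.Positive) (hS : S.Positive) (hh : IsTower T S h) {α β : 𝒜} {x y : ℝ}
    (hx : x ∈ S.cell α) (hy : y ∈ S.cell β) {i j : ℕ} (hi : i < h α) (hj : j < h β)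
    (heq : T.map^[i] x = T.map^[j] y) : α = β ∧ i = j ∧ x = y := by
  wlog hij : i ≤ j generalizing α β x y i j
  · obtain ⟨h1, h2, h3⟩ := this hy hx hj hi heq.symm (by omega)
    exact ⟨h1.symm, h2.symm, h3.symm⟩
  obtain ⟨k, rfl⟩ := Nat.exists_eq_add_of_le hij
  have hxm := cell_subset hS α hx
  have hym := cell_subset hS β hy
  rw [Function.iterate_add_apply] at heq
  have h1 := iterate_injOn hT i (hh.mem_total hxm) (iterate_mem hT (hh.mem_total hym) k) heq
  rcases Nat.eq_zero_or_pos k with rfl | hk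
  · have h2 : x = y := h1
    subst h2
    exact ⟨eq_of_mem_cell hS hx hy, rfl, rfl⟩
  · have := hh.le_iterate β y hy k hk (by omega)
    rw [← h1] at this
    exact absurd hxm.2 this.not_gt

/-- The singularities of `T` are left endpoints of floors. -/
theorem eq_p_of_iterate_eq (hT : T.Positive) (hS : S.Positive) (hh : IsTower T S h) {α β : 𝒜}
    {x : ℝ} (hx : x ∈ S.cell α) {j : ℕ} (hj : j < h α) (heq : T.map^[j] x = T.p β) :
    x = S.p α := by
  obtain ⟨γ, hγ⟩ := hh.floor α j hj
  have h1 := hγ x hx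
  rw [heq] at h1
  obtain rfl := eq_of_p_mem_cell hT h1
  have h2 := (hγ _ (p_mem_cell hS α)).1
  have h3 := hh.iterate_sub hT hx (p_mem_cell hS α) hj.le
  have h4 := hx.1
  linarith

variable [NeZero d] {S' : IEM 𝒜 d} {w l a b : 𝒜}

/-- The towers of an induced map are obtained from the old ones by stacking the tower over the cell
of `b` on the part of the tower over the cell of `a` which goes there. -/
theorem step [DecidableEq 𝒜] (hS : S.Positive) (hS' : S'.Positive)
    (hh : IsTower T S h) (hs : IsInducedStep S S' w l a b) :
    IsTower T S' (Function.update h l (h l + h w)) := by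
  have hl : Function.update h l (h l + h w) l = h a + h b := by
    rw [Function.update_self]
    rcases hs.pair with ⟨h1, h2⟩ | ⟨h1, h2⟩ <;> rw [h1, h2]
    exact add_comm _ _
  have hne : ∀ γ, γ ≠ l → Function.update h l (h l + h w) γ = h γ := fun γ hγ =>
    Function.update_of_ne hγ _ _
  have hadd : ∀ x ∈ S'.cell l, ∀ j, T.map^[j + h a] x = T.map^[j] (S.map x) := fun x hx j => by
    rw [Function.iterate_add_apply, hh.ret a x (hs.cell_loser hx)]
  have htot : S'.total ≤ S.total := by rw [hs.total_eq]; linarith [hS l]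
  have hle : ∀ γ, h γ ≤ Function.update h l (h l + h w) γ := by
    intro γ
    by_cases hγ : γ = l
    · subst hγ; rw [Function.update_self]; omega
    · rw [hne γ hγ]
  refine ⟨fun α => (hh.pos α).trans_le (hle α), htot.trans hh.total_le, ?_, ?_, ?_, ?_, ?_⟩
  · intro α x hx
    by_cases hα : α = l
    · subst hα
      obtain ⟨h1, h2, h3⟩ := hs.map_loser x hx
      rw [hl, add_comm, hadd x hx, hh.ret b _ h1, h3]
    · rw [hne α hα, hh.ret α x (hs.cell_of_ne α hα hx), hs.map_of_ne α hα x hx]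
  · intro α x hx j hj0 hj
    by_cases hα : α = l
    · subst hα
      obtain ⟨h1, h2, h3⟩ := hs.map_loser x hx
      rw [hl] at hj
      rcases lt_or_ge j (h a) with hja | hja
      · exact htot.trans (hh.le_iterate a x (hs.cell_loser hx) j hj0 hja)
      · obtain ⟨k, rfl⟩ := Nat.exists_eq_add_of_le' hja
        rw [hadd x hx]
        rcases Nat.eq_zero_or_pos k with rfl | hk
        · exact h2
        · exact htot.trans (hh.le_iterate b _ h1 k hk (by omega))
    · rw [hne α hα] at hj
      exact htot.trans (hh.le_iterate α x (hs.cell_of_ne α hα hx) j hj0 hj)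
  · intro α j hj
    by_cases hα : α = l
    · subst hα
      rw [hl] at hj
      rcases lt_or_ge j (h a) with hja | hja
      · obtain ⟨β, hβ⟩ := hh.floor a j hja
        exact ⟨β, fun x hx => hβ x (hs.cell_loser hx)⟩
      · obtain ⟨k, rfl⟩ := Nat.exists_eq_add_of_le' hja
        obtain ⟨β, hβ⟩ := hh.floor b k (by omega)
        refine ⟨β, fun x hx => ?_⟩
        rw [hadd x hx]
        exact hβ _ (hs.map_loser x hx).1
    · rw [hne α hα] at hj
      obtain ⟨β, hβ⟩ := hh.floor α j hj
      exact ⟨β, fun x hx => hβ x (hs.cell_of_ne α hα hx)⟩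
  · intro x hx
    obtain ⟨α, j, hj, y, hy, rfl⟩ := hh.cover x hx
    have hym := cell_subset hS α hy
    rcases lt_or_ge y S'.total with hlt | hge
    · obtain ⟨β, hβ⟩ := exists_mem_cell (T := S') ⟨hym.1, hlt⟩
      refine ⟨β, j, ?_, y, hβ, rfl⟩
      rcases hs.cell_eq hS hy hβ with rfl | ⟨rfl, rfl⟩
      · exact hj.trans_le (hle _)
      · rw [hl]; omega
    · obtain ⟨hyb, z, hz, rfl⟩ := hs.surj y ⟨hge, hym.2⟩
      obtain rfl := eq_of_mem_cell hS hy hyb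
      exact ⟨l, j + h a, by rw [hl]; omega, z, hz, hadd z hz j⟩
  · intro α
    obtain ⟨j, hj, β, h1, h2⟩ := hh.sing α
    by_cases hα : S'.p α = S.p α
    · rw [hα]
      exact ⟨j, hj.trans_le (hle α), β, h1, h2⟩
    · have hαl : α = l := by
        by_contra h0
        exact hα (hs.p_of_ne α h0)
      subst hαl
      obtain ⟨rfl, h3⟩ := hs.p_loser.resolve_left hα
      have hb : b = α := by
        rcases hs.pair with ⟨_, h4⟩ | ⟨h4, _⟩
        · exact h4
        · exact absurd h4 hs.ne
      refine ⟨j + h a, by rw [hl, hb]; omega, β, ?_, fun _ => h2 ?_⟩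
      · rw [hadd _ (p_mem_cell hS' _), h3, h1]
      · rw [← h3]
        refine (total_pos hS').trans_le (hs.map_loser _ (p_mem_cell hS' _)).2.1

end IsTower

/-- The Keane property of `T` excludes a tie in a Rauzy–Veech step of an induced map. -/
theorem IsTower.len_lastTop_ne [NeZero d] (hT : T.Positive) (hK : T.Keane) (hS : S.Positive)
    (hh : IsTower T S h) (hd : 2 ≤ d) :
    S.len S.lastTop ≠ S.len S.lastBot := by
  intro heq
  have h1 : S.map (S.p S.lastBot) = S.p S.lastTop := by
    rw [map_of_mem_cell hS (p_mem_cell hS _)]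
    linarith [p_lastTop (S := S), q_lastBot (S := S)]
  rw [← hh.ret _ _ (p_mem_cell hS _)] at h1
  have hpos : 0 < S.p S.lastTop := (p_pos_iff hS).mpr (by
    have := val_top (d := d)
    rw [top_lastTop]; omega)
  obtain ⟨i, hi, β, h2, -⟩ := hh.sing S.lastBot
  obtain ⟨j, hj, γ, h3, h4⟩ := hh.sing S.lastTop
  refine iterate_p_ne (α := β) (m := j + (h S.lastBot - i)) hT hK (by omega) (h4 hpos) ?_
  rw [← h3, ← h1, ← h2, ← Function.iterate_add_apply, ← Function.iterate_add_apply]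
  congr 1
  omega

end Towers

/-! ### Iteration of the algorithm -/

section Iterates

variable [NeZero d]

theorem iter_zero (T : IEM 𝒜 d) : T.iter 0 = T := rfl

theorem iter_succ (T : IEM 𝒜 d) (n : ℕ) : T.iter (n + 1) = (T.iter n).rauzy :=
  Function.iterate_succ_apply' _ _ _

/-- The return times of the points of `I_α(n)` to `[0, λ^*(n))` under `T`. -/
def height [DecidableEq 𝒜] (T : IEM 𝒜 d) : ℕ → 𝒜 → ℕ
  | 0 => fun _ => 1
  | n + 1 => Function.update (T.height n) (T.iter n).loser
      (T.height n (T.iter n).loser + T.height n (T.iter n).winner)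

variable [DecidableEq 𝒜] {T : IEM 𝒜 d}

theorem len_winner_succ (n : ℕ) : (T.iter (n + 1)).len (T.iter n).winner =
    (T.iter n).len (T.iter n).winner - (T.iter n).len (T.iter n).loser := by
  rw [iter_succ, rauzy_len_winner]

theorem len_succ_of_ne (n : ℕ) {γ : 𝒜} (h : γ ≠ (T.iter n).winner) :
    (T.iter (n + 1)).len γ = (T.iter n).len γ := by
  rw [iter_succ, rauzy_len_of_ne h]

theorem total_succ (n : ℕ) : (T.iter (n + 1)).total =
    (T.iter n).total - (T.iter n).len (T.iter n).loser := by
  rw [iter_succ, rauzy_total]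

theorem height_loser_succ (n : ℕ) : T.height (n + 1) (T.iter n).loser =
    T.height n (T.iter n).loser + T.height n (T.iter n).winner := Function.update_self _ _ _

theorem height_succ_of_ne (n : ℕ) {γ : 𝒜} (h : γ ≠ (T.iter n).loser) :
    T.height (n + 1) γ = T.height n γ := Function.update_of_ne h _ _

/-- When the winner changes, the old winner becomes the loser. -/
theorem winner_eq_loser_succ (n : ℕ) (h : (T.iter (n + 1)).winner ≠ (T.iter n).winner) :
    (T.iter (n + 1)).loser = (T.iter n).winner := by
  have h1 : (T.iter n).winner = (T.iter (n + 1)).lastTop ∨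
      (T.iter n).winner = (T.iter (n + 1)).lastBot := by
    rw [iter_succ]
    rcases rauzy_cases (T.iter n) with ⟨h1, h2, h3, h4⟩ | ⟨h1, h2, h3, h4⟩
    · left; rw [h1, lastTop, lastTop, h3]
    · right; rw [h1, lastBot, lastBot, h3]
  unfold winner loser at *
  split_ifs at * <;> rcases h1 with h1 | h1 <;> first | exact h1.symm | exact absurd h1.symm h

theorem iter_induction (hd : 2 ≤ d) (hT : T.Positive) (hA : T.Admissible) (hK : T.Keane) (n : ℕ) :
    (T.iter n).Positive ∧ (T.iter n).Admissible ∧ IsTower T (T.iter n) (T.height n) := by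
  induction n with
  | zero => exact ⟨hT, hA, isTower_self T⟩
  | succ n ih =>
    obtain ⟨h1, h2, h3⟩ := ih
    have hne := h2.lastTop_ne_lastBot hd
    have hlen := h3.len_lastTop_ne hT hK h1 hd
    obtain ⟨a, b, hs⟩ := exists_isInducedStep h1 hne hlen
    rw [iter_succ]
    have h1' := rauzy_positive h1 hlen
    exact ⟨h1', rauzy_admissible h2 hne, h3.step h1 h1' hs⟩

/-- The standing assumptions: an admissible interval exchange map with positive
lengths and the Keane property, on at least two letters. -/
structure Good (T : IEM 𝒜 d) : Prop where
  two_le : 2 ≤ d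
  pos : T.Positive
  adm : T.Admissible
  keane : T.Keane

namespace Good

variable (hT : T.Good) (n : ℕ)
include hT

theorem iter_pos : (T.iter n).Positive :=
  (iter_induction hT.two_le hT.pos hT.adm hT.keane n).1

theorem iter_adm : (T.iter n).Admissible :=
  (iter_induction hT.two_le hT.pos hT.adm hT.keane n).2.1

theorem tower : IsTower T (T.iter n) (T.height n) :=
  (iter_induction hT.two_le hT.pos hT.adm hT.keane n).2.2

theorem lastTop_ne : (T.iter n).lastTop ≠ (T.iter n).lastBot :=
  (hT.iter_adm n).lastTop_ne_lastBot hT.two_le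

theorem winner_ne : (T.iter n).winner ≠ (T.iter n).loser := winner_ne_loser (hT.lastTop_ne n)

theorem len_ne : (T.iter n).len (T.iter n).lastTop ≠ (T.iter n).len (T.iter n).lastBot :=
  (hT.tower n).len_lastTop_ne hT.pos hT.keane (hT.iter_pos n) hT.two_le

theorem step : ∃ a b, IsInducedStep (T.iter n) (T.iter (n + 1)) (T.iter n).winner
    (T.iter n).loser a b := by
  rw [iter_succ]
  exact exists_isInducedStep (hT.iter_pos n) (hT.lastTop_ne n) (hT.len_ne n)

theorem total_pos : 0 < (T.iter n).total := IEM.total_pos (hT.iter_pos n)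

theorem len_le_total (α : 𝒜) : (T.iter n).len α ≤ (T.iter n).total :=
  Finset.single_le_sum (f := (T.iter n).len) (fun β _ => (hT.iter_pos n β).le) (Finset.mem_univ α)

end Good

end Iterates

/-! ### All letters win infinitely often -/

section Stabilization

variable {ι : Type*} [Fintype ι]

/-- A set of letters which all precede the other letters is an initial segment of the row. -/
theorem lt_card_iff_mem [DecidableEq ι] {e : ι ≃ Fin d} {A : Finset ι}
    (h : ∀ a ∈ A, ∀ b ∉ A, e a < e b) (x : ι) : (e x : ℕ) < A.card ↔ x ∈ A := by
  constructor
  · intro hx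
    by_contra hxA
    have h1 : A.card ≤ (Finset.Iio (e x)).card := by
      rw [← Finset.card_map e.toEmbedding]
      refine Finset.card_le_card fun y hy => ?_
      obtain ⟨a, ha, rfl⟩ := Finset.mem_map.mp hy
      exact Finset.mem_Iio.mpr (h a ha x hxA)
    rw [Fin.card_Iio] at h1
    omega
  · intro hx
    have h1 : (Finset.Iic (e x)).card ≤ A.card := by
      rw [← Finset.card_map e.toEmbedding (s := A)]
      refine Finset.card_le_card fun y hy => ?_
      refine Finset.mem_map.mpr ⟨e.symm y, ?_, by simp⟩
      by_contra hy'
      have := h x hx _ hy'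
      rw [Equiv.apply_symm_apply] at this
      exact (Finset.mem_Iic.mp hy).not_gt this
    rw [Fin.card_Iic] at h1
    omega

/-- Suppose that in a row, evolving by Rauzy–Veech steps with winners `w n` and losers `l n`, all the
letters of `W` win infinitely often and eventually only letters of `W` lose. Then the
letters outside `W` eventually occupy the first places. -/
theorem eventually_initial [NeZero d] [DecidableEq ι] {e : ℕ → ι ≃ Fin d} {w l : ℕ → ι}
    (hne : ∀ n, w n ≠ l n)
    (hstep : ∀ n, (e (n + 1) = e n ∧ e n (w n) = ⊤) ∨
      (e n (l n) = ⊤ ∧ e (n + 1) = (e n).trans (insertAfter (e n (w n)))))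
    {W : Finset ι} (hW : ∀ a ∈ W, ∃ᶠ n in atTop, w n = a)
    (hl : ∀ᶠ n in atTop, l n ∈ W) :
    ∀ᶠ n in atTop, ∀ x, (e n x : ℕ) < Wᶜ.card ↔ x ∉ W := by
  obtain ⟨N, hN⟩ := eventually_atTop.mp hl
  have hmono : ∀ a ∉ W, ∀ n ≥ N, (e n a : ℕ) ≤ e (n + 1) a ∧
      ((e (n + 1) a : ℕ) = e n a → e (n + 1) = e n ∧ e n (w n) = ⊤ ∨
        e n a ≤ e n (w n) ∧ e n (l n) = ⊤ ∧
        e (n + 1) = (e n).trans (insertAfter (e n (w n)))) := by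
    intro a ha n hn
    rcases hstep n with ⟨h1, h2⟩ | ⟨h1, h2⟩
    · rw [h1]; exact ⟨le_rfl, fun _ => Or.inl ⟨rfl, h2⟩⟩
    · rw [h2]
      rcases le_or_gt (e n a) (e n (w n)) with h3 | h3
      · rw [insertAfter_of_le h1 (hne n) h3]
        exact ⟨le_rfl, fun _ => Or.inr ⟨h3, h1, rfl⟩⟩
      · have hal : a ≠ l n := fun h => ha (h ▸ hN n hn)
        rw [insertAfter_of_lt h1 (hne n) h3 hal]
        exact ⟨by omega, fun h => by omega⟩
  have hconst : ∀ a ∉ W, ∀ᶠ n in atTop, (e (n + 1) a : ℕ) = e n a := by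
    intro a ha
    have hm : Monotone fun n => (e (N + n) a : ℕ) :=
      monotone_nat_of_le_succ fun n => (hmono a ha (N + n) (by omega)).1
    have hfin : (Set.range fun n => (e (N + n) a : ℕ)).Finite :=
      (Set.finite_Iio d).subset (by rintro _ ⟨n, rfl⟩; exact (e (N + n) a).isLt)
    obtain ⟨_, ⟨n0, rfl⟩, hmax⟩ := hfin.exists_maximal ⟨_, ⟨0, rfl⟩⟩
    refine eventually_atTop.mpr ⟨N + n0, fun n hn => ?_⟩
    obtain ⟨k, rfl⟩ := Nat.exists_eq_add_of_le hn
    have hc : ∀ k, (e (N + (n0 + k)) a : ℕ) = e (N + n0) a := fun k =>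
      le_antisymm (hmax ⟨n0 + k, rfl⟩ (hm (Nat.le_add_right _ _))) (hm (Nat.le_add_right _ _))
    have h1 := hc k
    have h2 := hc (k + 1)
    rw [add_assoc N n0 k, h1, ← h2]
    rfl
  have hall : ∀ᶠ n in atTop, N ≤ n ∧ ∀ a, a ∉ W → (e (n + 1) a : ℕ) = e n a :=
    (eventually_ge_atTop N).and (eventually_all.mpr fun a => by
      by_cases ha : a ∈ W
      · exact Eventually.of_forall fun n h => absurd ha h
      · exact (hconst a ha).mono fun n h _ => h)
  obtain ⟨N', hN'⟩ := eventually_atTop.mp hall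
  refine eventually_atTop.mpr ⟨N', fun n hn x => ?_⟩
  rw [lt_card_iff_mem (A := Wᶜ), Finset.mem_compl]
  intro a ha b hb
  simp only [Finset.mem_compl, not_not] at ha hb
  by_contra hcon
  have hlt : e n b < e n a := lt_of_le_of_ne (not_lt.mp hcon) fun h =>
    ha ((e n).injective h ▸ hb)
  -- The relative order of `b` and `a` cannot change any more.
  have hkeep : ∀ k, e (n + k) b < e (n + k) a := by
    intro k
    induction k with
    | zero => exact hlt
    | succ k ih =>
      have h1 := (hN' (n + k) (by omega)).2 a ha
      rcases (hmono a ha (n + k) (hN' (n + k) (by omega)).1).2 h1 with ⟨h2, -⟩ | ⟨h2, h3, h4⟩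
      · rw [← add_assoc, h2]; exact ih
      · rw [← add_assoc, Fin.lt_def, h1, h4, insertAfter_of_le h3 (hne _) (ih.le.trans h2)]
        exact ih
  obtain ⟨m, hm, hwm⟩ := frequently_atTop.mp (hW b hb) n
  obtain ⟨k, rfl⟩ := Nat.exists_eq_add_of_le hm
  have h1 := (hN' (n + k) (by omega)).2 a ha
  rcases (hmono a ha (n + k) (hN' (n + k) (by omega)).1).2 h1 with ⟨-, h2⟩ | ⟨h2, -⟩
  · exact ((hwm ▸ h2 : e (n + k) b = ⊤) ▸ hkeep k).not_ge le_top
  · exact (hwm ▸ h2 : e (n + k) a ≤ e (n + k) b).not_gt (hkeep k)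

end Stabilization

namespace Good

variable [NeZero d] [DecidableEq 𝒜] {T : IEM 𝒜 d}

theorem total_antitone (hT : T.Good) : Antitone fun n => (T.iter n).total :=
  antitone_nat_of_succ_le fun n => by
    rw [total_succ]; linarith [hT.iter_pos n (T.iter n).loser]

/-- A letter which loses infinitely often wins infinitely often: otherwise its length would
eventually be constant, and be subtracted from the total length infinitely often. -/
theorem frequently_winner_of_loser (hT : T.Good) {α : 𝒜}
    (h : ∃ᶠ n in atTop, (T.iter n).loser = α) : ∃ᶠ n in atTop, (T.iter n).winner = α := by
  by_contra hcon
  rw [not_frequently] at hcon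
  obtain ⟨N, hN⟩ := eventually_atTop.mp hcon
  have hconst : ∀ k, (T.iter (N + k)).len α = (T.iter N).len α := by
    intro k
    induction k with
    | zero => rfl
    | succ k ih => rw [← ih, ← add_assoc, len_succ_of_ne _ (Ne.symm (hN _ (by omega)))]
  have hlim := tendsto_atTop_ciInf hT.total_antitone
    ⟨0, by rintro _ ⟨n, rfl⟩; exact (hT.total_pos n).le⟩
  have hdiff := hlim.sub ((tendsto_add_atTop_iff_nat 1).mpr hlim)
  rw [sub_self] at hdiff
  have hev := (hdiff.eventually_lt_const (hT.iter_pos N α)).and (eventually_ge_atTop N)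
  obtain ⟨n, h1, h2, h3⟩ := (h.and_eventually hev).exists
  obtain ⟨k, rfl⟩ := Nat.exists_eq_add_of_le h3
  simp only [total_succ] at h2
  rw [h1, hconst] at h2
  linarith

/-- The letters which win infinitely often are all of `𝒜`: otherwise the others would eventually
occupy the same first places in both rows. -/
theorem frequently_winner (hT : T.Good) (α : 𝒜) : ∃ᶠ n in atTop, (T.iter n).winner = α := by
  classical
  let W : Finset 𝒜 := Finset.univ.filter fun α => ∃ᶠ n in atTop, (T.iter n).winner = α
  have hmem : ∀ a, a ∈ W ↔ ∃ᶠ n in atTop, (T.iter n).winner = a := fun a => by simp [W]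
  by_contra hα
  have hl : ∀ᶠ n in atTop, (T.iter n).loser ∈ W := by
    have h1 : ∀ᶠ n in atTop, ∀ a, a ∉ W → (T.iter n).loser ≠ a := by
      refine eventually_all.mpr fun a => ?_
      by_cases ha : a ∈ W
      · exact Eventually.of_forall fun n h => absurd ha h
      · have : ¬ ∃ᶠ n in atTop, (T.iter n).loser = a := fun h =>
          ha ((hmem a).mpr (hT.frequently_winner_of_loser h))
        exact (not_frequently.mp this).mono fun n h _ => h
    exact h1.mono fun n h => by_contra fun h0 => h _ h0 rfl
  have hW : ∀ a ∈ W, ∃ᶠ n in atTop, (T.iter n).winner = a := fun a ha => (hmem a).mp ha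
  have htop := eventually_initial (e := fun n => (T.iter n).top) hT.winner_ne
    (fun n => by
      simp only [iter_succ]
      rcases rauzy_cases (T.iter n) with ⟨h1, h2, h3, h4⟩ | ⟨h1, h2, h3, h4⟩
      · exact Or.inl ⟨h3, by rw [h1, top_lastTop]⟩
      · exact Or.inr ⟨by rw [h2, top_lastTop], h4⟩) hW hl
  have hbot := eventually_initial (e := fun n => (T.iter n).bot) hT.winner_ne
    (fun n => by
      simp only [iter_succ]
      rcases rauzy_cases (T.iter n) with ⟨h1, h2, h3, h4⟩ | ⟨h1, h2, h3, h4⟩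
      · exact Or.inr ⟨by rw [h2, bot_lastBot], h4⟩
      · exact Or.inl ⟨h3, by rw [h1, bot_lastBot]⟩) hW hl
  obtain ⟨n, ⟨h1, h2⟩, h3⟩ := ((htop.and hbot).and hl).exists
  have hcard : Fintype.card 𝒜 = d := by
    rw [Fintype.card_congr T.top, Fintype.card_fin]
  refine hT.iter_adm n Wᶜ.card (Finset.card_pos.mpr ⟨α, ?_⟩) ?_ (Set.ext fun x => ?_)
  · rw [Finset.mem_compl, hmem]; exact hα
  · rw [← hcard]
    exact Finset.card_lt_univ_of_notMem (x := (T.iter n).loser) (by simpa using h3)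
  · rw [Set.mem_ofPred_eq, Set.mem_ofPred_eq, h1, h2]

theorem exists_winner_ge (hT : T.Good) (α : 𝒜) (N : ℕ) : ∃ n ≥ N, (T.iter n).winner = α :=
  frequently_atTop.mp (hT.frequently_winner α) N

end Good

/-! ### The cocycle -/

section Cocycle

variable [NeZero d] [DecidableEq 𝒜] {T : IEM 𝒜 d}

theorem card_eq (T : IEM 𝒜 d) : Fintype.card 𝒜 = d := by
  rw [Fintype.card_congr T.top, Fintype.card_fin]

theorem B_self (m : ℕ) : T.B m m = 1 := by rw [B, Nat.sub_self]; rfl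

theorem B_succ {m n : ℕ} (h : m ≤ n) : T.B m (n + 1) = T.arrowMatrix n * T.B m n := by
  rw [B, B, show n + 1 - m = (n - m) + 1 by omega, pathMatrix, show m + (n - m) = n by omega]

theorem B_succ_apply {m n : ℕ} (h : m ≤ n) (β α : 𝒜) : T.B m (n + 1) β α = T.B m n β α +
    if β = (T.iter n).loser then T.B m n (T.iter n).winner α else 0 := by
  rw [B_succ h, arrowMatrix, Matrix.add_mul, Matrix.one_mul, Matrix.add_apply]
  congr 1
  split_ifs with hβ
  · subst hβ; rw [Matrix.single_mul_apply_same, one_mul]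
  · rw [Matrix.single_mul_apply_of_ne _ _ _ _ _ hβ]

theorem B_mul {m n k : ℕ} (h1 : m ≤ n) (h2 : n ≤ k) : T.B m k = T.B n k * T.B m n := by
  induction k, h2 using Nat.le_induction with
  | base => rw [B_self, Matrix.one_mul]
  | succ k hk ih => rw [B_succ (h1.trans hk), B_succ hk, ih, Matrix.mul_assoc]

theorem B_nonneg (m n : ℕ) (β α : 𝒜) : 0 ≤ T.B m n β α := by
  rcases le_total m n with h | h
  · induction n, h using Nat.le_induction generalizing β with
    | base => rw [B_self, Matrix.one_apply]; split_ifs <;> simp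
    | succ n hn ih =>
      rw [B_succ_apply hn]
      split_ifs
      · exact add_nonneg (ih _) (ih _)
      · simpa using ih _
  · rw [B, Nat.sub_eq_zero_of_le h, pathMatrix, Matrix.one_apply]; split_ifs <;> simp

theorem B_mono {m n k : ℕ} (h1 : m ≤ n) (h2 : n ≤ k) (β α : 𝒜) :
    T.B m n β α ≤ T.B m k β α := by
  induction k, h2 using Nat.le_induction with
  | base => rfl
  | succ k hk ih =>
    rw [B_succ_apply (h1.trans hk)]
    split_ifs
    · exact ih.trans (le_add_of_nonneg_right (B_nonneg _ _ _ _))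
    · simpa using ih

theorem B_diag_pos {m n : ℕ} (h : m ≤ n) (α : 𝒜) : 0 < T.B m n α α := by
  have := B_mono (T := T) (le_refl m) h α α
  rw [B_self, Matrix.one_apply_eq] at this
  omega

theorem height_eq {m n : ℕ} (h : m ≤ n) (β : 𝒜) :
    (T.height n β : ℤ) = ∑ α, T.B m n β α * T.height m α := by
  induction n, h using Nat.le_induction generalizing β with
  | base => simp [B_self, Matrix.one_apply]
  | succ n hn ih =>
    simp only [B_succ_apply hn, add_mul, Finset.sum_add_distrib]
    rw [← ih]
    by_cases hβ : β = (T.iter n).loser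
    · subst hβ
      simp only [if_true]
      rw [← ih, height_loser_succ]
      push_cast; rfl
    · simp only [hβ, if_false, zero_mul, Finset.sum_const_zero, add_zero]
      rw [height_succ_of_ne _ hβ]

theorem height_le_of_pos {m n : ℕ} (h : m ≤ n) {β α : 𝒜} (hB : 0 < T.B m n β α) :
    T.height m α ≤ T.height n β := by
  have h1 : (T.height m α : ℤ) ≤ T.height n β := by
    rw [height_eq h]
    refine le_trans ?_ (Finset.single_le_sum (f := fun γ => T.B m n β γ * T.height m γ)
      (fun γ _ => mul_nonneg (B_nonneg _ _ _ _) (Int.natCast_nonneg _)) (Finset.mem_univ α))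
    nlinarith [Int.natCast_nonneg (T.height m α)]
  exact_mod_cast h1

theorem sum_height_le {m n : ℕ} (h : m ≤ n) (hB : ∀ β α, 0 < T.B m n β α) (β : 𝒜) :
    ∑ α, T.height m α ≤ T.height n β := by
  have h1 : ((∑ α, T.height m α : ℕ) : ℤ) ≤ T.height n β := by
    rw [height_eq h]
    push_cast
    refine Finset.sum_le_sum fun α _ => ?_
    nlinarith [Int.natCast_nonneg (T.height m α), hB β α]
  exact_mod_cast h1

theorem entryNorm_nonneg (A : Matrix 𝒜 𝒜 ℤ) : 0 ≤ entryNorm A :=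
  Finset.sum_nonneg fun _ _ => Finset.sum_nonneg fun _ _ => abs_nonneg _

theorem row_sum_le_entryNorm (A : Matrix 𝒜 𝒜 ℤ) (i : 𝒜) : ∑ j, |(A i j : ℝ)| ≤ entryNorm A :=
  Finset.single_le_sum (f := fun i => ∑ j, |(A i j : ℝ)|)
    (fun _ _ => Finset.sum_nonneg fun _ _ => abs_nonneg _) (Finset.mem_univ i)

theorem entryNorm_mul (A C : Matrix 𝒜 𝒜 ℤ) : entryNorm (A * C) ≤ entryNorm A * entryNorm C := by
  have h1 : ∀ i, ∑ j, |((A * C) i j : ℝ)| ≤ ∑ k, |(A i k : ℝ)| * entryNorm C := by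
    intro i
    calc ∑ j, |((A * C) i j : ℝ)| ≤ ∑ j, ∑ k, |(A i k : ℝ)| * |(C k j : ℝ)| := by
          refine Finset.sum_le_sum fun j _ => ?_
          rw [Matrix.mul_apply]
          push_cast
          refine (Finset.abs_sum_le_sum_abs _ _).trans (le_of_eq ?_)
          exact Finset.sum_congr rfl fun k _ => abs_mul _ _
      _ = ∑ k, |(A i k : ℝ)| * ∑ j, |(C k j : ℝ)| := by
          rw [Finset.sum_comm]
          exact Finset.sum_congr rfl fun k _ => (Finset.mul_sum _ _ _).symm
      _ ≤ _ := Finset.sum_le_sum fun k _ =>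
          mul_le_mul_of_nonneg_left (row_sum_le_entryNorm C k) (abs_nonneg _)
  calc entryNorm (A * C) ≤ ∑ i, ∑ k, |(A i k : ℝ)| * entryNorm C :=
        Finset.sum_le_sum fun i _ => h1 i
    _ = entryNorm A * entryNorm C := by
        simp only [← Finset.sum_mul]
        rfl

/-- A bound for the cocycle matrix bounds the growth of the return times. -/
theorem height_le_mul {m n : ℕ} (h : m ≤ n) {R : ℝ} (hR : ∀ α, (T.height m α : ℝ) ≤ R) (β : 𝒜) :
    (T.height n β : ℝ) ≤ entryNorm (T.B m n) * R := by
  have h1 : (T.height n β : ℝ) = ∑ α, (T.B m n β α : ℝ) * T.height m α := by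
    exact_mod_cast height_eq (T := T) h β
  have hR0 : 0 ≤ R := (Nat.cast_nonneg _).trans (hR β)
  calc (T.height n β : ℝ) ≤ ∑ α, |(T.B m n β α : ℝ)| * R := by
        rw [h1]
        exact Finset.sum_le_sum fun α _ => mul_le_mul (le_abs_self _) (hR α)
          (Nat.cast_nonneg _) (abs_nonneg _)
    _ ≤ _ := by
        rw [← Finset.sum_mul]
        exact mul_le_mul_of_nonneg_right (row_sum_le_entryNorm _ _) hR0

theorem exists_entryNorm_B_le (T : IEM 𝒜 d) :
    ∃ K : ℝ, 1 ≤ K ∧ ∀ m l, entryNorm (T.B m (m + l)) ≤ K ^ (l + 1) := by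
  have hα : (1 : ℝ) ≤ Fintype.card 𝒜 := by
    rw [Nat.one_le_cast, card_eq T]; exact NeZero.one_le
  have hK : ∀ A : Matrix 𝒜 𝒜 ℤ, (∀ i j, |(A i j : ℝ)| ≤ 2) →
      entryNorm A ≤ 2 * (Fintype.card 𝒜 : ℝ) ^ 2 := fun A hA => by
    calc entryNorm A ≤ ∑ _i : 𝒜, ∑ _j : 𝒜, (2 : ℝ) :=
          Finset.sum_le_sum fun i _ => Finset.sum_le_sum fun j _ => hA i j
      _ = _ := by simp; ring
  refine ⟨2 * (Fintype.card 𝒜 : ℝ) ^ 2, by nlinarith, fun m l => ?_⟩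
  induction l with
  | zero =>
    rw [add_zero, B_self, zero_add, pow_one]
    refine hK _ fun i j => ?_
    rw [Matrix.one_apply]
    split_ifs <;> norm_num
  | succ l ih =>
    rw [← add_assoc, B_succ (by omega), pow_succ']
    refine (entryNorm_mul _ _).trans
      (mul_le_mul (hK _ fun i j => ?_) ih (entryNorm_nonneg _) (by positivity))
    rw [arrowMatrix, Matrix.add_apply, Matrix.one_apply, Matrix.single_apply]
    split_ifs <;> norm_num

end Cocycle

namespace Good

variable [NeZero d] [DecidableEq 𝒜] {T : IEM 𝒜 d}

theorem len_eq (hT : T.Good) {m n : ℕ} (h : m ≤ n) (α : 𝒜) :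
    (T.iter m).len α = ∑ β, (T.iter n).len β * T.B m n β α := by
  induction n, h using Nat.le_induction with
  | base => simp [B_self, Matrix.one_apply]
  | succ n hn ih =>
    rw [ih]
    simp only [B_succ_apply hn, Int.cast_add, mul_add, Finset.sum_add_distrib]
    have h1 : ∀ β, (T.iter (n + 1)).len β = (T.iter n).len β +
        if β = (T.iter n).winner then - (T.iter n).len (T.iter n).loser else 0 := by
      intro β
      split_ifs with hβ
      · subst hβ; rw [len_winner_succ]; ring
      · rw [len_succ_of_ne _ hβ, add_zero]
    have h2 : (T.iter (n + 1)).len (T.iter n).loser = (T.iter n).len (T.iter n).loser :=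
      len_succ_of_ne _ (hT.winner_ne n).symm
    have h3 : ∑ β, (T.iter (n + 1)).len β * (T.B m n β α : ℝ) =
        ∑ β, (T.iter n).len β * (T.B m n β α : ℝ) -
          (T.iter n).len (T.iter n).loser * T.B m n (T.iter n).winner α := by
      simp only [h1, add_mul, Finset.sum_add_distrib, ite_mul, zero_mul]
      rw [Finset.sum_ite_eq' Finset.univ]
      simp
      ring
    have h4 : ∑ β, (T.iter (n + 1)).len β * (((if β = (T.iter n).loser then
        T.B m n (T.iter n).winner α else 0 : ℤ)) : ℝ) =
        (T.iter n).len (T.iter n).loser * T.B m n (T.iter n).winner α := by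
      rw [Finset.sum_eq_single (T.iter n).loser]
      · rw [if_pos rfl, h2]
      · intro β _ hβ; simp [hβ]
      · intro h; exact absurd (Finset.mem_univ _) h
    rw [h3, h4]
    ring

theorem total_le_len (hT : T.Good) {m n : ℕ} (h : m ≤ n) (hB : ∀ β α, 0 < T.B m n β α) (α : 𝒜) :
    (T.iter n).total ≤ (T.iter m).len α := by
  rw [hT.len_eq h]
  refine Finset.sum_le_sum fun β _ => ?_
  have h1 : (1 : ℝ) ≤ T.B m n β α := by exact_mod_cast hB β α
  nlinarith [hT.iter_pos n β]

theorem total_le_mul (hT : T.Good) {m n : ℕ} (h : m ≤ n) :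
    (T.iter m).total ≤ entryNorm (T.B m n) * (T.iter n).total := by
  calc (T.iter m).total = ∑ β, (T.iter n).len β * ∑ α, (T.B m n β α : ℝ) := by
        unfold total
        rw [Finset.sum_congr rfl fun α _ => hT.len_eq h α, Finset.sum_comm]
        exact Finset.sum_congr rfl fun β _ => (Finset.mul_sum _ _ _).symm
    _ ≤ ∑ β, (T.iter n).len β * entryNorm (T.B m n) := by
        refine Finset.sum_le_sum fun β _ =>
          mul_le_mul_of_nonneg_left ?_ (hT.iter_pos n β).le
        exact (Finset.sum_le_sum fun _ _ => le_abs_self _).trans (row_sum_le_entryNorm _ β)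
    _ = _ := by rw [← Finset.sum_mul, mul_comm]; rfl

/-- The towers fill the whole interval. -/
theorem total_eq_sum (hT : T.Good) (m : ℕ) :
    T.total = ∑ β, (T.iter m).len β * T.height m β := by
  have h1 : ∀ β, (T.height m β : ℝ) = ∑ α, (T.B 0 m β α : ℝ) := fun β => by
    have := height_eq (T := T) (Nat.zero_le m) β
    simp only [height, Nat.cast_one, mul_one] at this
    exact_mod_cast this
  simp only [h1, Finset.mul_sum]
  rw [Finset.sum_comm]
  exact Finset.sum_congr rfl fun α _ => hT.len_eq (Nat.zero_le m) α

theorem total_le_height_mul (hT : T.Good) (m : ℕ) {R : ℝ} (hR : ∀ α, (T.height m α : ℝ) ≤ R) :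
    T.total ≤ R * (T.iter m).total := by
  rw [hT.total_eq_sum m]
  calc ∑ β, (T.iter m).len β * T.height m β ≤ ∑ β, (T.iter m).len β * R :=
        Finset.sum_le_sum fun β _ => mul_le_mul_of_nonneg_left (hR β) (hT.iter_pos m β).le
    _ = R * (T.iter m).total := by rw [← Finset.sum_mul, mul_comm]; rfl

end Good

/-! ### Zorich and Marmi–Moussa–Yoccoz times -/

namespace Good

variable [NeZero d] [DecidableEq 𝒜] {T : IEM 𝒜 d}

theorem exists_ne_letter (hT : T.Good) (α : 𝒜) : ∃ β, β ≠ α := by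
  have : Nontrivial 𝒜 := Fintype.one_lt_card_iff_nontrivial.mp (by
    rw [card_eq T]; exact hT.two_le)
  exact exists_ne α

/-- The supremum in the definition of the Marmi–Moussa–Yoccoz times is a maximum, since
every letter wins again. -/
theorem mmyTime_mem (hT : T.Good) (k : ℕ) : T.mmyTime (k + 1) ∈ {n | T.mmyTime k < n ∧
      ∃ α, ∀ i, T.mmyTime k ≤ i → i < n → (T.iter i).winner ≠ α} ∧
    BddAbove {n | T.mmyTime k < n ∧
      ∃ α, ∀ i, T.mmyTime k ≤ i → i < n → (T.iter i).winner ≠ α} := by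
  have hbdd : BddAbove {n | T.mmyTime k < n ∧
      ∃ α, ∀ i, T.mmyTime k ≤ i → i < n → (T.iter i).winner ≠ α} := by
    choose f hf1 hf2 using fun α => hT.exists_winner_ge α (T.mmyTime k)
    refine ⟨∑ α, f α, ?_⟩
    rintro n ⟨-, α, hα⟩
    by_contra hlt
    exact hα (f α) (hf1 α) ((Finset.single_le_sum (fun _ _ => Nat.zero_le _)
      (Finset.mem_univ α)).trans_lt (not_le.mp hlt)) (hf2 α)
  refine ⟨Nat.sSup_mem ?_ hbdd, hbdd⟩
  obtain ⟨β, hβ⟩ := hT.exists_ne_letter (T.iter (T.mmyTime k)).winner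
  exact ⟨T.mmyTime k + 1, by omega, β, fun i h1 h2 => by
    obtain rfl : i = T.mmyTime k := by omega
    exact hβ.symm⟩

theorem mmyTime_lt (hT : T.Good) (k : ℕ) : T.mmyTime k < T.mmyTime (k + 1) :=
  (hT.mmyTime_mem k).1.1

theorem mmyTime_strictMono (hT : T.Good) : StrictMono T.mmyTime :=
  strictMono_nat_of_lt_succ hT.mmyTime_lt

theorem exists_not_winner_mmyTime (hT : T.Good) (k : ℕ) :
    ∃ α, ∀ i, T.mmyTime k ≤ i → i < T.mmyTime (k + 1) → (T.iter i).winner ≠ α :=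
  (hT.mmyTime_mem k).1.2

theorem exists_winner_mmyTime (hT : T.Good) (k : ℕ) (α : 𝒜) :
    ∃ i, T.mmyTime k ≤ i ∧ i ≤ T.mmyTime (k + 1) ∧ (T.iter i).winner = α := by
  by_contra hcon
  push Not at hcon
  have : T.mmyTime (k + 1) + 1 ≤ T.mmyTime (k + 1) :=
    le_csSup (hT.mmyTime_mem k).2 ⟨by have := hT.mmyTime_lt k; omega, α, fun i h1 h2 =>
      hcon i h1 (by omega)⟩
  omega

/-- All the letters except for the winner of the next arrow win between consecutive
Marmi–Moussa–Yoccoz times. -/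
theorem exists_winner_lt_mmyTime (hT : T.Good) (k : ℕ) {α : 𝒜}
    (hα : α ≠ (T.iter (T.mmyTime (k + 1))).winner) :
    ∃ i, T.mmyTime k ≤ i ∧ i < T.mmyTime (k + 1) ∧ (T.iter i).winner = α := by
  obtain ⟨i, h1, h2, h3⟩ := hT.exists_winner_mmyTime k α
  refine ⟨i, h1, lt_of_le_of_ne h2 ?_, h3⟩
  rintro rfl
  exact hα h3.symm

/-- The supremum in the definition of the Zorich times is a maximum, since every letter
wins again. -/
theorem zorichTime_mem (hT : T.Good) (k : ℕ) : T.zorichTime k < T.zorichTime (k + 1) ∧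
      ∃ α, ∀ i, T.zorichTime k ≤ i → i < T.zorichTime (k + 1) → (T.iter i).winner = α := by
  refine Nat.sSup_mem (s := {n | T.zorichTime k < n ∧
      ∃ α, ∀ i, T.zorichTime k ≤ i → i < n → (T.iter i).winner = α}) ?_ ?_
  · exact ⟨T.zorichTime k + 1, by omega, _, fun i h1 h2 => by
      obtain rfl : i = T.zorichTime k := by omega
      rfl⟩
  · obtain ⟨β, hβ⟩ := hT.exists_ne_letter (T.iter (T.zorichTime k)).winner
    obtain ⟨n, h1, h2⟩ := hT.exists_winner_ge β (T.zorichTime k)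
    refine ⟨n, ?_⟩
    rintro m ⟨h3, α, hα⟩
    by_contra hlt
    refine hβ ?_
    rw [← h2, hα n h1 (by omega), hα _ le_rfl h3]

theorem zorichTime_strictMono (hT : T.Good) : StrictMono T.zorichTime :=
  strictMono_nat_of_lt_succ fun k => (hT.zorichTime_mem k).1

end Good

/-! ### Positivity of the cocycle -/

section Support

variable [NeZero d] [DecidableEq 𝒜] {T : IEM 𝒜 d}

/-- The support of the column of `α` in the matrix `B(m, n)`. -/
def supp (T : IEM 𝒜 d) (m : ℕ) (α : 𝒜) (n : ℕ) : Finset 𝒜 :=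
  Finset.univ.filter fun β => 0 < T.B m n β α

theorem mem_supp {m n : ℕ} {α β : 𝒜} : β ∈ supp T m α n ↔ 0 < T.B m n β α := by simp [supp]

theorem supp_mono {m n k : ℕ} (h1 : m ≤ n) (h2 : n ≤ k) (α : 𝒜) :
    supp T m α n ⊆ supp T m α k := fun β hβ => by
  rw [mem_supp] at *
  exact hβ.trans_le (B_mono h1 h2 β α)

theorem loser_mem_supp {m n : ℕ} (h : m ≤ n) {α : 𝒜} (hw : (T.iter n).winner ∈ supp T m α n) :
    (T.iter n).loser ∈ supp T m α (n + 1) := by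
  rw [mem_supp] at *
  rw [B_succ_apply h, if_pos rfl]
  exact add_pos_of_nonneg_of_pos (B_nonneg _ _ _ _) hw

/-- If the winner passes from the complement of the support to the support, then in the last
step it beats a letter outside the support, so that the support grows. -/
theorem exists_supp_grows {m i₀ i j : ℕ} (hm : m ≤ i₀) (hi : i₀ ≤ i) (hij : i < j) {α : 𝒜}
    (h1 : (T.iter i).winner ∉ supp T m α i₀) (h2 : (T.iter j).winner ∈ supp T m α i₀) :
    ∃ k, i < k ∧ k ≤ j ∧ (T.iter k).winner ∈ supp T m α (k + 1) ∧
      (supp T m α i₀).card + 1 ≤ (supp T m α (k + 1)).card := by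
  induction j, (show i + 1 ≤ j from hij) using Nat.le_induction with
  | base =>
    refine ⟨i + 1, by omega, le_rfl, supp_mono hm (by omega) α h2, ?_⟩
    have hl := winner_eq_loser_succ (T := T) i fun h => h1 (h ▸ h2)
    have h3 := loser_mem_supp (T := T) (m := m) (n := i + 1) (α := α) (by omega)
      (supp_mono hm (by omega) α h2)
    rw [hl] at h3
    exact Finset.card_lt_card ⟨supp_mono hm (by omega) α, fun h => h1 (h h3)⟩
  | succ j hj ih =>
    by_cases h3 : (T.iter j).winner ∈ supp T m α i₀
    · obtain ⟨k, h4, h5, h6⟩ := ih (by omega) h3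
      exact ⟨k, h4, by omega, h6⟩
    · refine ⟨j + 1, by omega, le_rfl, supp_mono hm (by omega) α h2, ?_⟩
      have hl := winner_eq_loser_succ (T := T) j fun h => h3 (h ▸ h2)
      have h4 := loser_mem_supp (T := T) (m := m) (n := j + 1) (α := α) (by omega)
        (supp_mono hm (by omega) α h2)
      rw [hl] at h4
      exact Finset.card_lt_card ⟨supp_mono hm (by omega) α, fun h => h3 (h h4)⟩

end Support

namespace Good

variable [NeZero d] [DecidableEq 𝒜] {T : IEM 𝒜 d}

/-- A support has at least `s + 2` elements after some arrow which starts not later than the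
Marmi–Moussa–Yoccoz time of index `k + 2s + 1`: it gets a second element when `α` wins for the first
time, and afterwards one more in every two periods, as letters outside and inside the
support win in turn. The inequality is strict for `s ≥ 1`, because then a letter of the support is
available which wins before the end of the second period. -/
theorem exists_card_supp (hT : T.Good) (k : ℕ) (α : 𝒜) (s : ℕ) (hs : s + 2 ≤ d) :
    ∃ i, T.mmyTime k ≤ i ∧ i ≤ T.mmyTime (k + 2 * s + 1) ∧
      (1 ≤ s → i < T.mmyTime (k + 2 * s + 1)) ∧
      (T.iter i).winner ∈ supp T (T.mmyTime k) α (i + 1) ∧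
      s + 2 ≤ (supp T (T.mmyTime k) α (i + 1)).card := by
  have hmono := hT.mmyTime_strictMono
  induction s with
  | zero =>
    -- The first win of `α` adds its loser to the support `{α}`.
    obtain ⟨i, h1, h2, h3⟩ := hT.exists_winner_mmyTime k α
    have hα : ∀ n, T.mmyTime k ≤ n → α ∈ supp T (T.mmyTime k) α n := fun n hn =>
      mem_supp.mpr (B_diag_pos hn α)
    refine ⟨i, h1, by simpa using h2, by omega, by rw [h3]; exact hα (i + 1) (by omega), ?_⟩
    have h4 : (T.iter i).loser ∈ supp T (T.mmyTime k) α (i + 1) :=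
      loser_mem_supp h1 (by rw [h3]; exact hα i h1)
    refine Finset.one_lt_card.mpr ⟨α, hα _ (by omega), _, h4, ?_⟩
    have := hT.winner_ne i
    rwa [h3] at this
  | succ s ih =>
    obtain ⟨i, h1, h2, -, h3, h4⟩ := ih (by omega)
    have hlt1 : T.mmyTime (k + 2 * s + 1) < T.mmyTime (k + 2 * s + 2) := hmono (by omega)
    have hlt2 : T.mmyTime (k + 2 * s + 2) < T.mmyTime (k + 2 * s + 3) := hmono (by omega)
    rw [show k + 2 * (s + 1) + 1 = k + 2 * s + 3 by ring]
    by_cases hfull : supp T (T.mmyTime k) α (i + 1) = Finset.univ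
    · refine ⟨i, h1, by omega, fun _ => by omega, h3, ?_⟩
      rw [hfull, Finset.card_univ, card_eq T]
      omega
    · obtain ⟨β, hβ⟩ := Finset.not_subset.mp fun h => hfull (Finset.univ_subset_iff.mp h)
      obtain ⟨j, hj1, hj2, hj3⟩ : ∃ j, T.mmyTime (k + 2 * s + 1) ≤ j ∧
          j ≤ T.mmyTime (k + 2 * s + 2) ∧ (T.iter j).winner = β :=
        hT.exists_winner_mmyTime (k + 2 * s + 1) β
      have hij : i + 1 ≤ j := by
        rcases (show i ≤ j by omega).eq_or_lt with rfl | h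
        · exact absurd (hj3 ▸ h3) hβ.2
        · exact h
      obtain ⟨γ, hγ, hγ'⟩ := Finset.exists_mem_ne (by omega : 1 < (supp T (T.mmyTime k) α (i + 1)).card)
        (T.iter (T.mmyTime (k + 2 * s + 3))).winner
      obtain ⟨j', hj1', hj2', hj3'⟩ : ∃ j, T.mmyTime (k + 2 * s + 2) ≤ j ∧
          j < T.mmyTime (k + 2 * s + 3) ∧ (T.iter j).winner = γ :=
        hT.exists_winner_lt_mmyTime (k + 2 * s + 2) hγ'
      have hjj : j < j' := by
        rcases (show j ≤ j' by omega).eq_or_lt with rfl | h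
        · exact absurd (by rwa [← hj3, hj3'] : β ∈ supp T (T.mmyTime k) α (i + 1)) hβ.2
        · exact h
      obtain ⟨n, hn1, hn2, hn3, hn4⟩ := exists_supp_grows (T := T) (m := T.mmyTime k)
        (i₀ := i + 1) (α := α) (by omega) hij hjj (hj3 ▸ hβ.2) (hj3' ▸ hγ)
      exact ⟨n, by omega, by omega, fun _ => by omega, hn3, by omega⟩

/-- The cocycle matrix over `max (2d - 3) 2` consecutive Marmi–Moussa–Yoccoz periods is positive. -/
theorem B_mmyTime_pos (hT : T.Good) (k : ℕ) (β α : 𝒜) :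
    0 < T.B (T.mmyTime k) (T.mmyTime (k + max (2 * d - 3) 2)) β α := by
  have hd := hT.two_le
  have hmono := hT.mmyTime_strictMono
  obtain ⟨i, h1, h2, h3, -, h5⟩ := hT.exists_card_supp k α (d - 2) (by omega)
  have huniv : supp T (T.mmyTime k) α (i + 1) = Finset.univ := by
    rw [← Finset.card_eq_iff_eq_univ, card_eq T]
    refine le_antisymm ?_ (by omega)
    exact (Finset.card_le_univ _).trans_eq (card_eq T)
  have hle : i + 1 ≤ T.mmyTime (k + max (2 * d - 3) 2) := by
    rcases (show 2 = d ∨ 3 ≤ d by omega) with rfl | h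
    · have : T.mmyTime (k + 1) < T.mmyTime (k + 2) := hmono (by omega)
      norm_num at h2 ⊢
      omega
    · have := h3 (by omega)
      rw [show k + 2 * (d - 2) + 1 = k + max (2 * d - 3) 2 by omega] at this
      omega
  exact mem_supp.mp (supp_mono (by omega) hle α (huniv ▸ Finset.mem_univ β))

theorem exists_B_pos (hT : T.Good) (m : ℕ) : ∃ m₀ ≥ m, ∀ n ≥ m₀, ∀ β α, 0 < T.B m n β α := by
  have hmono := hT.mmyTime_strictMono
  have h1 : m ≤ T.mmyTime m := hmono.le_apply
  have h2 : T.mmyTime m ≤ T.mmyTime (m + max (2 * d - 3) 2) := hmono.monotone (by omega)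
  refine ⟨_, h1.trans h2, fun n hn β α => ?_⟩
  rw [B_mul h1 (h2.trans hn), Matrix.mul_apply]
  refine (mul_pos ((hT.B_mmyTime_pos m β α).trans_le (B_mono h2 hn β α))
    (B_diag_pos (T := T) h1 α)).trans_le ?_
  exact Finset.single_le_sum (f := fun γ => T.B (T.mmyTime m) n β γ * T.B m (T.mmyTime m) γ α)
    (fun γ _ => mul_nonneg (B_nonneg _ _ _ _) (B_nonneg _ _ _ _)) (Finset.mem_univ α)

end Good

/-! ### Minimality -/

namespace Good

variable [NeZero d] [DecidableEq 𝒜] {T : IEM 𝒜 d}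

theorem exists_total_lt (hT : T.Good) {ε : ℝ} (hε : 0 < ε) : ∃ n, (T.iter n).total < ε := by
  have key : ∀ j : ℕ, ∃ n, 2 ^ j * (T.iter n).total ≤ T.total := by
    intro j
    induction j with
    | zero => exact ⟨0, by simp [iter_zero]⟩
    | succ j ih =>
      obtain ⟨m, hm⟩ := ih
      obtain ⟨n, hn, hB⟩ := hT.exists_B_pos m
      refine ⟨n, le_trans ?_ hm⟩
      rw [pow_succ, mul_assoc]
      refine mul_le_mul_of_nonneg_left ?_ (by positivity)
      calc 2 * (T.iter n).total ≤ (d : ℝ) * (T.iter n).total := by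
            refine mul_le_mul_of_nonneg_right ?_ (hT.total_pos n).le
            exact_mod_cast hT.two_le
        _ = ∑ _α : 𝒜, (T.iter n).total := by
            rw [Finset.sum_const, Finset.card_univ, card_eq T, nsmul_eq_mul]
        _ ≤ (T.iter m).total :=
            Finset.sum_le_sum fun α _ => hT.total_le_len hn (hB n le_rfl) α
  obtain ⟨j, hj⟩ := pow_unbounded_of_one_lt (T.total / ε) (one_lt_two (α := ℝ))
  obtain ⟨n, hn⟩ := key j
  refine ⟨n, ?_⟩
  rw [div_lt_iff₀ hε] at hj
  exact lt_of_mul_lt_mul_left (hn.trans_lt hj) (by positivity)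

theorem exists_le_height (hT : T.Good) (R : ℕ) : ∃ m₀, ∀ n ≥ m₀, ∀ β, R ≤ T.height n β := by
  induction R with
  | zero => exact ⟨0, fun _ _ _ => Nat.zero_le _⟩
  | succ R ih =>
    obtain ⟨m, hm⟩ := ih
    obtain ⟨m₀, hm₀, hB⟩ := hT.exists_B_pos m
    refine ⟨m₀, fun n hn β => ?_⟩
    obtain ⟨γ, hγ⟩ := hT.exists_ne_letter β
    have h1 : T.height m β + T.height m γ ≤ ∑ α, T.height m α := by
      rw [← Finset.sum_pair hγ.symm]
      exact Finset.sum_le_sum_of_subset (Finset.subset_univ _)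
    have h2 := sum_height_le (hm₀.trans hn) (hB n hn) β
    have h3 := hm m le_rfl β
    have h4 := (hT.tower m).pos γ
    omega

/-- A positive entry of the cocycle matrix says that the tower over `I_β(n)` crosses
the one over `I_α(m)`. -/
theorem exists_iterate_mem_cell (hT : T.Good) {m n : ℕ} (h : m ≤ n) {β α : 𝒜}
    (hB : 0 < T.B m n β α) : ∃ i, i + T.height m α ≤ T.height n β ∧
      ∀ y ∈ (T.iter n).cell β, T.map^[i] y ∈ (T.iter m).cell α := by
  induction n, h using Nat.le_induction generalizing β with
  | base =>
    obtain rfl : β = α := by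
      by_contra h
      rw [B_self, Matrix.one_apply_ne h] at hB
      exact lt_irrefl _ hB
    exact ⟨0, by omega, fun y hy => hy⟩
  | succ n hn ih =>
    obtain ⟨a, b, hs⟩ := hT.step n
    rw [B_succ_apply hn] at hB
    by_cases hβ : β = (T.iter n).loser
    · subst hβ
      have hheight : T.height (n + 1) (T.iter n).loser = T.height n a + T.height n b := by
        rw [height_loser_succ]
        rcases hs.pair with ⟨h1, h2⟩ | ⟨h1, h2⟩ <;> rw [h1, h2]
        exact add_comm _ _
      have hab : 0 < T.B m n a α ∨ 0 < T.B m n b α := by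
        rw [if_pos rfl] at hB
        have h1 := B_nonneg (T := T) m n (T.iter n).loser α
        have h2 := B_nonneg (T := T) m n (T.iter n).winner α
        rcases hs.pair with ⟨h3, h4⟩ | ⟨h3, h4⟩ <;> rw [h3, h4] <;> omega
      rcases hab with hab | hab
      · obtain ⟨i, h1, h2⟩ := ih hab
        exact ⟨i, by omega, fun y hy => h2 y (hs.cell_loser hy)⟩
      · obtain ⟨i, h1, h2⟩ := ih hab
        refine ⟨i + T.height n a, by omega, fun y hy => ?_⟩
        rw [Function.iterate_add_apply, (hT.tower n).ret a y (hs.cell_loser hy)]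
        exact h2 _ (hs.map_loser y hy).1
    · rw [if_neg hβ, add_zero] at hB
      obtain ⟨i, h1, h2⟩ := ih hB
      rw [height_succ_of_ne n hβ]
      exact ⟨i, h1, fun y hy => h2 y (hs.cell_of_ne β hβ hy)⟩

/-- From some moment on, all the towers have a floor in a given interval. -/
theorem exists_floor_subset (hT : T.Good) {a b : ℝ} (ha : 0 ≤ a) (hab : a < b)
    (hb : b ≤ T.total) : ∃ m₀, ∀ n ≥ m₀, ∀ β, ∃ i < T.height n β,
      ∀ y ∈ (T.iter n).cell β, T.map^[i] y ∈ Set.Ioo a b := by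
  obtain ⟨m, hm⟩ := hT.exists_total_lt (ε := (b - a) / 2) (by linarith)
  obtain ⟨α, j, hj, y, hy, hyc⟩ := (hT.tower m).cover ((a + b) / 2) ⟨by linarith, by linarith⟩
  obtain ⟨m₀, hm₀, hB⟩ := hT.exists_B_pos m
  refine ⟨m₀, fun n hn β => ?_⟩
  obtain ⟨i, hi, hmem⟩ := hT.exists_iterate_mem_cell (hm₀.trans hn) (hB n hn β α)
  refine ⟨j + i, by omega, fun z hz => ?_⟩
  have h1 := hmem z hz
  have h2 := (hT.tower m).iterate_sub hT.pos h1 hy hj.le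
  have h3 := hT.len_le_total m α
  rw [Function.iterate_add_apply]
  rw [hyc] at h2
  have h4 := h1.1
  have h5 := h1.2
  have h6 := hy.1
  have h7 := hy.2
  constructor <;> linarith

theorem exists_iterate_mem (hT : T.Good) {a b : ℝ} (ha : 0 ≤ a) (hab : a < b)
    (hb : b ≤ T.total) {x : ℝ} (hx : x ∈ Set.Ico 0 T.total) : ∃ i, T.map^[i] x ∈ Set.Ioo a b := by
  obtain ⟨n, hn⟩ := hT.exists_floor_subset ha hab hb
  have htow := hT.tower n
  obtain ⟨β, j, hj, y, hy, rfl⟩ := htow.cover x hx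
  obtain ⟨γ, hγ⟩ := exists_mem_cell
    (map_mem (hT.iter_pos n) (cell_subset (hT.iter_pos n) β hy))
  obtain ⟨i, -, hi⟩ := hn n le_rfl γ
  refine ⟨i + (T.height n β - j), ?_⟩
  rw [← Function.iterate_add_apply, show i + (T.height n β - j) + j = i + T.height n β by omega,
    Function.iterate_add_apply, htow.ret β y hy]
  exact hi _ hγ

end Good

/-! ### Discontinuities and gaps -/

section Discontinuities

variable {T : IEM 𝒜 d}

theorem mem_discont {n : ℕ} (hT : T.Positive) {x : ℝ} : x ∈ T.discont n ↔ x = 0 ∨ x = T.total ∨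
    (x ∈ Set.Ico 0 T.total ∧ ∃ j < n, ∃ β, 0 < T.p β ∧ T.map^[j] x = T.p β) := by
  simp only [discont, Set.mem_union, Set.mem_insert_iff, Set.mem_singleton_iff,
    Set.mem_ofPred_eq, p_pos_iff hT, or_assoc]

theorem gap_le {n : ℕ} {x y : ℝ} (hx : x ∈ T.discont n) (hy : y ∈ T.discont n)
    (hxy : x ≠ y) : T.gap n ≤ |x - y| :=
  csInf_le ⟨0, by rintro _ ⟨x, -, y, -, -, rfl⟩; exact abs_nonneg _⟩ ⟨x, hx, y, hy, hxy, rfl⟩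

theorem discont_mono (T : IEM 𝒜 d) {n m : ℕ} (h : n ≤ m) : T.discont n ⊆ T.discont m := by
  rintro x (hx | ⟨hx, j, hj, hβ⟩)
  · exact Or.inl hx
  · exact Or.inr ⟨hx, j, by omega, hβ⟩

variable [NeZero d]

theorem le_gap (hT : T.Positive) {n : ℕ} {c : ℝ}
    (h : ∀ x ∈ T.discont n, ∀ y ∈ T.discont n, x < y → c ≤ y - x) : c ≤ T.gap n := by
  refine le_csInf ⟨_, 0, (mem_discont hT).mpr (Or.inl rfl), T.total,
    (mem_discont hT).mpr (Or.inr (Or.inl rfl)), (IEM.total_pos hT).ne, rfl⟩ ?_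
  rintro _ ⟨x, hx, y, hy, hxy, rfl⟩
  rcases lt_or_gt_of_ne hxy with hlt | hlt
  · rw [abs_sub_comm, abs_of_pos (by linarith)]; exact h x hx y hy hlt
  · rw [abs_of_pos (by linarith)]; exact h y hy x hx hlt

variable {n : ℕ}

theorem mem_Icc_of_mem_discont (hT : T.Positive) {x : ℝ} (hx : x ∈ T.discont n) :
    x ∈ Set.Icc 0 T.total := by
  have := total_pos hT
  rcases (mem_discont hT).mp hx with rfl | rfl | h
  · exact ⟨le_rfl, this.le⟩
  · exact ⟨this.le, le_rfl⟩
  · exact ⟨h.1.1, h.1.2.le⟩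

theorem mem_discont_of_iterate (hT : T.Positive) {i : ℕ} {z : ℝ} (hz : z ∈ Set.Ico 0 T.total)
    (h : T.map^[i] z ∈ T.discont n) (h0 : T.map^[i] z ≠ 0) : z ∈ T.discont (n + i) := by
  rcases (mem_discont hT).mp h with h1 | h1 | ⟨-, j, hj, β, hβ, heq⟩
  · exact absurd h1 h0
  · exact absurd h1 (iterate_mem hT hz i).2.ne
  · exact (mem_discont hT).mpr (Or.inr (Or.inr ⟨hz, j + i, by omega, β, hβ, by
      rw [Function.iterate_add_apply, heq]⟩))

theorem finite_discont (hT : T.Positive) (n : ℕ) : (T.discont n).Finite := by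
  refine Set.Finite.union (Set.toFinite _) ?_
  refine Set.Finite.subset (s := ⋃ j : Fin n, ⋃ β : 𝒜,
    {x | x ∈ Set.Ico 0 T.total ∧ T.map^[j] x = T.p β}) ?_ ?_
  · refine Set.finite_iUnion fun j => Set.finite_iUnion fun β => ?_
    refine Set.Subsingleton.finite fun x hx y hy => ?_
    exact iterate_injOn hT j hx.1 hy.1 (hx.2.trans hy.2.symm)
  · rintro x ⟨hx, j, hj, β, -, heq⟩
    exact Set.mem_iUnion.mpr ⟨⟨j, hj⟩, Set.mem_iUnion.mpr ⟨β, hx, heq⟩⟩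

end Discontinuities

/-! ### Bounded type implies large gaps -/

namespace Good

variable [NeZero d] [DecidableEq 𝒜] {T : IEM 𝒜 d}

/-- If the return times at time `m` are at least `n`, and the interval at time `m'` is contained in
the first cell at time `m`, then the discontinuities of `T^n` are left endpoints of floors of the
towers at time `m'`: a point hitting a singularity in less than `n` steps has to do so
before the return to this first cell, from where only the left endpoint `0` could do so. -/
theorem discont_subset (hT : T.Good) {m m' n : ℕ}
    (hn : ∀ α, n ≤ T.height m α) (hle : ∀ α, (T.iter m').total ≤ (T.iter m).len α) {x : ℝ}
    (hx : x ∈ T.discont n) (hxt : x ≠ T.total) :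
    ∃ γ, ∃ i < T.height m' γ, T.map^[i] ((T.iter m').p γ) = x := by
  have htow := hT.tower m'
  rcases (mem_discont hT.pos).mp hx with rfl | h | ⟨hxm, j, hj, β, hβ, heq⟩
  · obtain ⟨γ, hγ⟩ := (T.iter m').exists_p_eq_zero
    exact ⟨γ, 0, htow.pos γ, hγ⟩
  · exact absurd h hxt
  · obtain ⟨γ, i, hi, y, hy, rfl⟩ := htow.cover x hxm
    rw [← Function.iterate_add_apply] at heq
    rcases lt_or_ge (j + i) (T.height m' γ) with hlt | hge
    · exact ⟨γ, i, hi, by rw [← htow.eq_p_of_iterate_eq hT.pos (hT.iter_pos m') hy hlt heq]⟩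
    · exfalso
      obtain ⟨k, hk⟩ := Nat.exists_eq_add_of_le' hge
      rw [hk, Function.iterate_add_apply, htow.ret γ y hy] at heq
      have hy' := map_mem (hT.iter_pos m') (cell_subset (hT.iter_pos m') γ hy)
      obtain ⟨α, hα⟩ := (T.iter m).exists_p_eq_zero
      have hmem : (T.iter m').map y ∈ (T.iter m).cell α :=
        ⟨by rw [hα]; exact hy'.1, by rw [hα]; linarith [hy'.2, hle α]⟩
      have h0 := (hT.tower m).eq_p_of_iterate_eq hT.pos (hT.iter_pos m) hmem
        (j := k) (by have := hn α; omega) heq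
      rw [h0, hα] at heq
      exact iterate_zero_ne hT.pos hT.keane k hβ heq

/-- Under the assumptions of `discont_subset`, distinct discontinuities of `T^n` are separated by
a whole floor of a tower at time `m'`. -/
theorem le_gap_of_height (hT : T.Good) {m m' n : ℕ} (hn : ∀ α, n ≤ T.height m α)
    (hle : ∀ α, (T.iter m').total ≤ (T.iter m).len α) {c : ℝ} (hc : ∀ α, c ≤ (T.iter m').len α) :
    c ≤ T.gap n := by
  have htow := hT.tower m'
  have hpos := hT.iter_pos m'
  refine le_gap hT.pos fun x hx y hy hxy => ?_
  have hyle : y ≤ T.total := by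
    rcases (mem_discont hT.pos).mp hy with rfl | h | h
    · exact (IEM.total_pos hT.pos).le
    · exact h.le
    · exact h.1.2.le
  obtain ⟨γ, i, hi, rfl⟩ := hT.discont_subset hn hle hx (hxy.trans_le hyle).ne
  refine (hc γ).trans ?_
  by_contra hlt
  set x := T.map^[i] ((T.iter m').p γ) with hxdef
  -- Otherwise `y` is an interior point of the floor which starts at `x`.
  have hz : (T.iter m').p γ + (y - x) ∈ (T.iter m').cell γ := ⟨by linarith, by linarith⟩
  have hyz : T.map^[i] ((T.iter m').p γ + (y - x)) = y := by
    have := htow.iterate_sub hT.pos hz (p_mem_cell hpos γ) hi.le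
    rw [← hxdef] at this
    linarith
  have hyt : y ≠ T.total := by
    have := (iterate_mem hT.pos (htow.mem_total (cell_subset hpos γ hz)) i).2
    rw [hyz] at this
    exact this.ne
  obtain ⟨γ', i', hi', heq⟩ := hT.discont_subset hn hle hy hyt
  obtain ⟨rfl, rfl, -⟩ := htow.floor_unique hT.pos hpos hz (p_mem_cell hpos γ') hi hi'
    (hyz.trans heq.symm)
  exact hxy.ne heq

theorem entryNorm_B_mmyTime_le (hT : T.Good) {M : ℝ} (hM : T.MMYBoundedBy M) (k j : ℕ) (hj : 1 ≤ j) :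
    entryNorm (T.B (T.mmyTime k) (T.mmyTime (k + j))) ≤ M ^ j := by
  have hM0 : 0 ≤ M := (entryNorm_nonneg _).trans (hM 0)
  induction j, hj using Nat.le_induction with
  | base => simpa using hM k
  | succ j hj ih =>
    have hmono := hT.mmyTime_strictMono.monotone
    rw [B_mul (hmono (Nat.le_add_right k j)) (hmono (by omega : k + j ≤ k + (j + 1))), pow_succ']
    exact (entryNorm_mul _ _).trans (mul_le_mul (hM (k + j)) ih (entryNorm_nonneg _) hM0)

theorem one_lt_of_mmyBoundedBy (hT : T.Good) {M : ℝ} (hM : T.MMYBoundedBy M) : 1 < M := by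
  have h1 : (d : ℝ) ≤ entryNorm (T.B (T.mmyTime 0) (T.mmyTime 1)) := by
    have hsum : (d : ℝ) = ∑ _α : 𝒜, 1 := by
      rw [Finset.sum_const, Finset.card_univ, card_eq T, nsmul_eq_mul, mul_one]
    rw [hsum, entryNorm]
    refine Finset.sum_le_sum fun α _ => ?_
    refine le_trans ?_ (Finset.single_le_sum
      (f := fun β => |(T.B (T.mmyTime 0) (T.mmyTime 1) α β : ℝ)|)
      (fun _ _ => abs_nonneg _) (Finset.mem_univ α))
    refine le_trans ?_ (le_abs_self _)
    exact_mod_cast B_diag_pos (hT.mmyTime_lt 0).le α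
  have h2 : (2 : ℝ) ≤ d := by exact_mod_cast hT.two_le
  linarith [hM 0]

/-- The return times at the first Marmi–Moussa–Yoccoz time at which all of them are
at least `n` are comparable to `n`. -/
theorem exists_mmyTime_height (hT : T.Good) {M : ℝ} (hM : T.MMYBoundedBy M) {r : ℕ}
    (hr : r = max (2 * d - 3) 2) {n : ℕ} (hn : 1 ≤ n) :
    ∃ k, ∀ α, n ≤ T.height (T.mmyTime k) α ∧
      (T.height (T.mmyTime k) α : ℝ) ≤ M ^ (r + 1) * n := by
  classical
  have hM1 := hT.one_lt_of_mmyBoundedBy hM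
  have hmono := hT.mmyTime_strictMono
  have hn1 : (1 : ℝ) ≤ n := by exact_mod_cast hn
  have hex : ∃ k, ∀ α, n ≤ T.height (T.mmyTime k) α := by
    obtain ⟨m, hm⟩ := hT.exists_le_height n
    exact ⟨m, fun α => hm _ hmono.le_apply α⟩
  refine ⟨Nat.find hex, fun α => ⟨Nat.find_spec hex α, ?_⟩⟩
  rcases Nat.eq_zero_or_pos (Nat.find hex) with h0 | hpos
  · rw [h0]
    have h1 : T.height (T.mmyTime 0) α = 1 := rfl
    rw [h1, Nat.cast_one]
    exact one_le_mul_of_one_le_of_one_le (one_le_pow₀ hM1.le) hn1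
  · obtain ⟨k, hk⟩ := Nat.exists_eq_add_of_le' hpos
    obtain ⟨α₀, hα₀⟩ := not_forall.mp (Nat.find_min hex (m := k) (by omega))
    rw [hk]
    rcases lt_or_ge k r with hkr | hkr
    · have h1 := height_le_mul (T := T) (hmono.monotone (Nat.zero_le (0 + (k + 1)))) (R := 1)
        (fun α => by rw [show T.height (T.mmyTime 0) α = 1 from rfl, Nat.cast_one]) α
      rw [Nat.zero_add] at h1
      have h2 := hT.entryNorm_B_mmyTime_le hM 0 (k + 1) (by omega)
      rw [Nat.zero_add] at h2
      have h3 : M ^ (k + 1) ≤ M ^ (r + 1) := pow_le_pow_right₀ hM1.le (by omega)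
      have h4 : 0 ≤ M ^ (r + 1) := by positivity
      nlinarith
    · obtain ⟨k, rfl⟩ := Nat.exists_eq_add_of_le' hkr
      have h1 : ∀ β, (T.height (T.mmyTime k) β : ℝ) ≤ n := by
        intro β
        have h2 := height_le_of_pos (T := T) (hmono.monotone (Nat.le_add_right k r))
          (hr ▸ hT.B_mmyTime_pos k α₀ β)
        exact_mod_cast h2.trans (not_le.mp hα₀).le
      have h2 := height_le_mul (T := T) (hmono.monotone (Nat.le_add_right k (r + 1))) h1 α
      exact h2.trans (mul_le_mul_of_nonneg_right
        (hT.entryNorm_B_mmyTime_le hM k (r + 1) (by omega)) (by linarith))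

theorem lt_gap_of_mmyBoundedBy (hT : T.Good) {M : ℝ} (hM : T.MMYBoundedBy M) {n : ℕ}
    (hn : 1 ≤ n) : T.total / (M ^ (4 * max (2 * d - 3) 2) * n) < T.gap n := by
  set r := max (2 * d - 3) 2 with hr
  have hM1 := hT.one_lt_of_mmyBoundedBy hM
  have hn0 : (0 : ℝ) < n := by exact_mod_cast hn
  obtain ⟨k, hk⟩ := hT.exists_mmyTime_height hM hr hn
  have hmono := hT.mmyTime_strictMono.monotone
  have hle1 : T.mmyTime k ≤ T.mmyTime (k + r) := hmono (by omega)
  have hle2 : T.mmyTime (k + r) ≤ T.mmyTime (k + r + r) := hmono (by omega)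
  refine lt_of_lt_of_le ?_ (hT.le_gap_of_height (fun α => (hk α).1)
    (fun α => hT.total_le_len hle1 (hT.B_mmyTime_pos k) α)
    (fun α => hT.total_le_len hle2 (hT.B_mmyTime_pos (k + r)) α))
  have h1 := hT.total_le_height_mul _ fun α => (hk α).2
  have h2 := hT.total_le_mul (hle1.trans hle2)
  have h3 := hT.entryNorm_B_mmyTime_le hM k (r + r) (by omega)
  rw [← add_assoc] at h3
  have ht := hT.total_pos (T.mmyTime (k + r + r))
  have hM0 : 0 < M := by linarith
  have h4 : T.total ≤ M ^ (r + 1) * n * (M ^ (r + r) * (T.iter (T.mmyTime (k + r + r))).total) := by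
    refine h1.trans (mul_le_mul_of_nonneg_left ?_ (by positivity))
    exact h2.trans (mul_le_mul_of_nonneg_right h3 ht.le)
  rw [div_lt_iff₀ (by positivity)]
  refine h4.trans_lt ?_
  have h5 : M ^ (r + 1) * M ^ (r + r) < M ^ (4 * r) := by
    rw [← pow_add]
    exact pow_lt_pow_right₀ hM1 (by omega)
  have h6 : 0 < (n : ℝ) * (T.iter (T.mmyTime (k + r + r))).total := by positivity
  nlinarith [mul_lt_mul_of_pos_right h5 h6]

end Good

/-! ### Continuity intervals of the iterates -/

section ContIntervals

/-- `[a, b)` is a maximal interval without discontinuities of `T^n` in its interior. -/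
structure IsContInterval (T : IEM 𝒜 d) (n : ℕ) (a b : ℝ) : Prop where
  left : a ∈ T.discont n
  right : b ∈ T.discont n
  lt : a < b
  notMem : ∀ z, a < z → z < b → z ∉ T.discont n

variable [NeZero d] {T : IEM 𝒜 d} {n : ℕ} {a b : ℝ}

theorem exists_isContInterval (hT : T.Positive) (n : ℕ) {x : ℝ} (hx : x ∈ Set.Ico 0 T.total) :
    ∃ a b, IsContInterval T n a b ∧ x ∈ Set.Ico a b := by
  have hfin := finite_discont hT n
  obtain ⟨a, ⟨ha, hax⟩, hamax⟩ := Set.exists_max_image (T.discont n ∩ Set.Iic x) id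
    (hfin.inter_of_left _) ⟨0, (mem_discont hT).mpr (Or.inl rfl), hx.1⟩
  obtain ⟨b, ⟨hb, hbx⟩, hbmin⟩ := Set.exists_min_image (T.discont n ∩ Set.Ioi x) id
    (hfin.inter_of_left _) ⟨T.total, (mem_discont hT).mpr (Or.inr (Or.inl rfl)), hx.2⟩
  refine ⟨a, b, ⟨ha, hb, lt_of_le_of_lt hax hbx, fun z h1 h2 hz => ?_⟩, hax, hbx⟩
  rcases le_or_gt z x with h | h
  · exact (hamax z ⟨hz, h⟩).not_gt h1
  · exact (hbmin z ⟨hz, h⟩).not_gt h2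

namespace IsContInterval

theorem subset (hT : T.Positive) (h : IsContInterval T n a b) : Set.Ico a b ⊆ Set.Ico 0 T.total :=
  fun _ hx => ⟨(mem_Icc_of_mem_discont hT h.left).1.trans hx.1,
    hx.2.trans_le (mem_Icc_of_mem_discont hT h.right).2⟩

theorem left_mem (h : IsContInterval T n a b) : a ∈ Set.Ico a b := ⟨le_rfl, h.lt⟩

/-- `T^n` is a translation on its continuity intervals. -/
theorem iterate_eq (hT : T.Positive) (h : IsContInterval T n a b) {x : ℝ} (hx : x ∈ Set.Ico a b)
    {j : ℕ} (hj : j ≤ n) : T.map^[j] x = T.map^[j] a + (x - a) := by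
  induction j generalizing x with
  | zero => simp
  | succ j ih =>
    have hxm := iterate_mem hT (h.subset hT hx) j
    have ham := iterate_mem hT (h.subset hT h.left_mem) j
    obtain ⟨γ, hγ⟩ := exists_mem_cell ham
    obtain ⟨δ, hδ⟩ := exists_mem_cell hxm
    have hxj := ih hx (by omega)
    obtain rfl : γ = δ := by
      by_contra hne
      -- The left endpoint of the cell of `T^j x` would pull back into the interior.
      have hlt : T.map^[j] a < T.p δ := by
        by_contra hle
        exact hne (eq_of_mem_cell hT hγ ⟨not_lt.mp hle, by linarith [hx.1, hδ.2]⟩)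
      have hδ1 := hδ.1
      have hz : a + (T.p δ - T.map^[j] a) ∈ Set.Ico a b := ⟨by linarith, by linarith [hx.2]⟩
      refine h.notMem _ (by linarith) hz.2 ((mem_discont hT).mpr (Or.inr (Or.inr
        ⟨h.subset hT hz, j, by omega, δ, ham.1.trans_lt hlt, ?_⟩)))
      rw [ih hz (by omega)]
      ring
    rw [Function.iterate_succ_apply', Function.iterate_succ_apply', map_of_mem_cell hT hγ,
      map_of_mem_cell hT hδ, hxj]
    ring

/-- The image of a continuity interval of a later iterate contains no discontinuity of
`T^n` in its interior. -/
theorem not_lt_le {N : ℕ} {A B : ℝ} (hT : T.Positive) (h : IsContInterval T N A B) {x y : ℝ}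
    (hx : x ∈ Set.Ico A B) (hy : y ∈ Set.Ico A B) {j : ℕ} (hj : j + n ≤ N) {e : ℝ}
    (he : e ∈ T.discont n) (h1 : T.map^[j] x < e) (h2 : e ≤ T.map^[j] y) : False := by
  have hxj := h.iterate_eq hT hx (j := j) (by omega)
  have hyj := h.iterate_eq hT hy (j := j) (by omega)
  have hx1 := hx.1
  have hy2 := hy.2
  have hz : x + (e - T.map^[j] x) ∈ Set.Ico A B := ⟨by linarith, by linarith⟩
  have hzj := h.iterate_eq hT hz (j := j) (by omega)
  have hze : T.map^[j] (x + (e - T.map^[j] x)) = e := by linarith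
  have hx0 := (iterate_mem hT (h.subset hT hx) j).1
  refine h.notMem _ (by linarith) hz.2 (discont_mono T (by omega : n + j ≤ N)
    (mem_discont_of_iterate hT (h.subset hT hz) (hze.symm ▸ he) ?_))
  rw [hze]
  linarith

theorem iterate_mem_iff {N : ℕ} {A B : ℝ} (hT : T.Positive) (h : IsContInterval T n a b)
    (hN : IsContInterval T N A B) {x y : ℝ} (hx : x ∈ Set.Ico A B) (hy : y ∈ Set.Ico A B) {j : ℕ}
    (hj : j + n ≤ N) (hxj : T.map^[j] x ∈ Set.Ico a b) : T.map^[j] y ∈ Set.Ico a b := by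
  constructor
  · by_contra hlt
    exact hN.not_lt_le hT hy hx hj h.left (not_le.mp hlt) hxj.1
  · by_contra hle
    exact hN.not_lt_le hT hx hy hj h.right hxj.2 (not_lt.mp hle)

end IsContInterval

end ContIntervals

/-! ### Large gaps imply large displacements -/

namespace Good

variable [NeZero d] [DecidableEq 𝒜] {T : IEM 𝒜 d} {n : ℕ} {a b c : ℝ}

/-- By admissibility `0` is the image of a singularity other than `0`, so it is not periodic. -/
theorem iterate_zero_ne_zero (hT : T.Good) {n : ℕ} (hn : 1 ≤ n) : T.map^[n] 0 ≠ 0 := by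
  intro h
  obtain ⟨n, rfl⟩ := Nat.exists_eq_add_of_le' hn
  have hd := hT.two_le
  set α := T.bot.symm 0 with hα
  have hq : T.q α = 0 := offset_first (by simp [hα])
  have hp : 0 < T.p α := by
    rw [p_pos_iff hT.pos]
    by_contra h0
    refine hT.adm 1 le_rfl (by omega) (Set.ext fun β => ?_)
    have h1 : (T.top β : ℕ) < 1 ↔ β = α := by
      rw [← T.top.injective.eq_iff, Fin.ext_iff]; omega
    have h2 : (T.bot β : ℕ) < 1 ↔ β = α := by
      rw [← T.bot.injective.eq_iff, Fin.ext_iff]; simp [hα]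
    rw [Set.mem_ofPred_eq, Set.mem_ofPred_eq, h1, h2]
  have h0 : (0 : ℝ) ∈ Set.Ico 0 T.total := ⟨le_rfl, IEM.total_pos hT.pos⟩
  have h1 : T.map (T.p α) = 0 := by
    rw [map_of_mem_cell hT.pos (p_mem_cell hT.pos α), hq]; ring
  rw [Function.iterate_succ_apply'] at h
  exact iterate_zero_ne hT.pos hT.keane n hp
    (map_injOn hT.pos (iterate_mem hT.pos h0 n) (p_mem hT.pos α)
      (h.trans h1.symm))

theorem exists_p_pos (hT : T.Good) : ∃ β, 0 < T.p β :=
  ⟨T.top.symm ⟨1, hT.two_le⟩, (p_pos_iff hT.pos).mpr (by simp)⟩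

theorem div_le_length (hD : ∀ n : ℕ, 1 ≤ n → c / n ≤ T.gap n) (hn : 1 ≤ n)
    (h : IsContInterval T n a b) : c / n ≤ b - a := by
  have := (hD n hn).trans (gap_le h.right h.left h.lt.ne')
  rwa [abs_of_pos (by linarith [h.lt])] at this

/-- If the gaps are large, then `T^n` has a large displacement: it translates the continuity interval
of `x` by some `δ`, and if `δ` is small then an endpoint of this interval and its
preimage are discontinuities of `T^{2n}` at distance `|δ|`. -/
theorem div_le_displacement (hT : T.Good) (hc : 0 < c) (hD : ∀ n : ℕ, 1 ≤ n → c / n ≤ T.gap n)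
    (hn : 1 ≤ n) {x : ℝ} (hx : x ∈ Set.Ico 0 T.total) : c / (2 * n) ≤ |T.map^[n] x - x| := by
  obtain ⟨a, b, h, hxab⟩ := exists_isContInterval hT.pos n hx
  have hn0 : (0 : ℝ) < n := by exact_mod_cast hn
  have hlen := div_le_length hD hn h
  have hhalf : c / (2 * n) ≤ c / n := by
    refine div_le_div_of_nonneg_left hc.le hn0 ?_
    linarith
  have hD2 := hD (n + n) (by omega)
  rw [show ((n + n : ℕ) : ℝ) = 2 * n by push_cast; ring] at hD2
  set δ := T.map^[n] a - a with hδ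
  have htr : ∀ z ∈ Set.Ico a b, T.map^[n] z = z + δ := fun z hz => by
    rw [h.iterate_eq hT.pos hz le_rfl]; ring
  rw [htr x hxab, add_sub_cancel_left]
  have hab := h.lt
  have ham := h.subset hT.pos h.left_mem
  rcases lt_trichotomy δ 0 with hneg | hzero | hpos
  · rw [abs_of_neg hneg]
    by_contra hcon
    have hz : a - δ ∈ Set.Ico a b := ⟨by linarith, by linarith⟩
    have hza : T.map^[n] (a - δ) = a := by rw [htr _ hz]; ring
    have ha0 : a ≠ 0 := by
      rintro rfl
      have := (iterate_mem hT.pos ham n).1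
      rw [htr 0 h.left_mem] at this
      linarith
    have h1 := mem_discont_of_iterate hT.pos (h.subset hT.pos hz) (hza.symm ▸ h.left)
      (hza.symm ▸ ha0)
    have h2 := gap_le h1 (discont_mono T (Nat.le_add_right n n) h.left) (by linarith)
    rw [show a - δ - a = -δ by ring, abs_of_pos (by linarith)] at h2
    linarith
  · exfalso
    have hfix : T.map^[n] a = a := by rw [htr a h.left_mem, hzero, add_zero]
    rcases (mem_discont hT.pos).mp h.left with rfl | h1 | ⟨-, j, hj, β, hβ, heq⟩
    · exact hT.iterate_zero_ne_zero hn hfix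
    · exact ham.2.ne h1
    · refine iterate_p_ne (α := β) hT.pos hT.keane hn hβ ?_
      rw [← heq, ← Function.iterate_add_apply, add_comm, Function.iterate_add_apply, hfix]
  · rw [abs_of_pos hpos]
    by_contra hcon
    have hz : b - δ ∈ Set.Ico a b := ⟨by linarith, by linarith⟩
    have hzb : T.map^[n] (b - δ) = b := by rw [htr _ hz]; ring
    have h1 := mem_discont_of_iterate hT.pos (h.subset hT.pos hz) (hzb.symm ▸ h.right)
      (hzb.symm ▸ (ham.1.trans_lt hab).ne')
    have h2 := gap_le h1 (discont_mono T (Nat.le_add_right n n) h.right) (by linarith)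
    rw [show b - δ - b = -δ by ring, abs_neg, abs_of_pos hpos] at h2
    linarith

theorem condU_of_condD (hT : T.Good) (hD : T.CondD) : T.CondU := by
  obtain ⟨c, hc, hD⟩ := hD
  refine ⟨c / 2, by positivity, fun x hx => le_liminf_of_le (h := ?_)⟩
  filter_upwards [eventually_ge_atTop 1] with n hn
  have hn0 : (0 : ℝ) < n := by exact_mod_cast hn
  have h1 := hT.div_le_displacement hc hD hn hx
  have h2 : c / 2 ≤ n * |T.map^[n] x - x| := by
    rw [div_le_iff₀ (by positivity)] at h1
    linarith
  exact_mod_cast h2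

end Good

/-! ### Large gaps imply short visit times -/

theorem sum_length_le {ι : Type*} (s : Finset ι) (u l : ι → ℝ) {L : ℝ}
    (hl : ∀ i ∈ s, 0 ≤ l i) (hL : 0 ≤ L)
    (hsub : ∀ i ∈ s, Set.Ico (u i) (u i + l i) ⊆ Set.Ico 0 L)
    (hdisj : ∀ i ∈ s, ∀ j ∈ s, i ≠ j → Disjoint (Set.Ico (u i) (u i + l i))
      (Set.Ico (u j) (u j + l j))) : ∑ i ∈ s, l i ≤ L := by
  have h1 : MeasureTheory.volume (⋃ i ∈ s, Set.Ico (u i) (u i + l i)) =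
      ∑ i ∈ s, ENNReal.ofReal (l i) := by
    rw [MeasureTheory.measure_biUnion_finset (fun i hi j hj hij => hdisj i hi j hj hij)
      fun i _ => measurableSet_Ico]
    refine Finset.sum_congr rfl fun i _ => ?_
    rw [Real.volume_Ico]
    congr 1
    ring
  have h2 : MeasureTheory.volume (⋃ i ∈ s, Set.Ico (u i) (u i + l i)) ≤ ENNReal.ofReal L := by
    refine (MeasureTheory.measure_mono (Set.iUnion₂_subset hsub)).trans_eq ?_
    rw [Real.volume_Ico, sub_zero]
  rw [h1, ← ENNReal.ofReal_sum_of_nonneg hl] at h2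
  exact (ENNReal.ofReal_le_ofReal_iff hL).mp h2

/-- A partial sum of the harmonic series is at least the corresponding logarithm. -/
theorem log_div_le_sum (n t : ℕ) (hn : 1 ≤ n) :
    Real.log ((t + n + 1) / n) ≤ ∑ s ∈ Finset.range (t + 1), 1 / ((s : ℝ) + n) := by
  have hn0 : (0 : ℝ) < n := by exact_mod_cast hn
  have key : ∀ x : ℝ, 0 < x → Real.log (x + 1) ≤ Real.log x + 1 / x := by
    intro x hx
    have h1 := Real.log_le_sub_one_of_pos (x := (x + 1) / x) (by positivity)
    rw [Real.log_div (by positivity) hx.ne'] at h1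
    have h2 : (x + 1) / x - 1 = 1 / x := by field_simp; ring
    linarith
  rw [Real.log_div (by positivity) hn0.ne']
  induction t with
  | zero =>
    have := key n hn0
    simp only [Nat.cast_zero, zero_add, Finset.sum_range_one] at *
    linarith
  | succ t ih =>
    rw [Finset.sum_range_succ]
    have := key (t + n + 1) (by positivity)
    push_cast at *
    rw [show (t : ℝ) + 1 + n + 1 = t + n + 1 + 1 by ring, show (t : ℝ) + 1 + n = t + n + 1 by ring]
    linarith

namespace Good

variable [NeZero d] [DecidableEq 𝒜] {T : IEM 𝒜 d} {n : ℕ} {a b c : ℝ}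

/-- If an orbit starting in a continuity interval `J` of `T^n` does not return to `J` up to time `t`,
then the images `T^s(K_s)`, `s ≤ t`, of the continuity intervals `K_s` of `T^{s+n}` around
the starting point are disjoint: the points of `T^s(K_s)` have left `J` exactly `s` steps ago. So the
sum of their lengths is bounded, although it grows like a logarithm of `t/n`. -/
theorem add_le_of_avoid (hT : T.Good) (hc : 0 < c) (hD : ∀ n : ℕ, 1 ≤ n → c / n ≤ T.gap n)
    (hn : 1 ≤ n) (h : IsContInterval T n a b) {y : ℝ} (hy : y ∈ Set.Ico a b) {t : ℕ}
    (hav : ∀ j, 1 ≤ j → j ≤ t → T.map^[j] y ∉ Set.Ico a b) :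
    (t + n + 1 : ℝ) ≤ Real.exp (T.total / c) * n := by
  have hn0 : (0 : ℝ) < n := by exact_mod_cast hn
  choose A B hAB hyAB using fun s : ℕ =>
    exists_isContInterval hT.pos (s + n) (h.subset hT.pos hy)
  have hsub : ∀ s, Set.Ico (A s) (B s) ⊆ Set.Ico a b := fun s z hz =>
    (h.iterate_mem_iff hT.pos (hAB s) (hyAB s) hz (j := 0) (by omega) hy)
  have himg : ∀ s, ∀ w ∈ Set.Ico (T.map^[s] (A s)) (T.map^[s] (A s) + (B s - A s)),
      ∃ z ∈ Set.Ico (A s) (B s), T.map^[s] z = w := by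
    intro s w hw
    have hz : A s + (w - T.map^[s] (A s)) ∈ Set.Ico (A s) (B s) :=
      ⟨by linarith [hw.1], by linarith [hw.2]⟩
    exact ⟨_, hz, by rw [(hAB s).iterate_eq hT.pos hz (by omega)]; ring⟩
  have hdisj : ∀ s s' : ℕ, s < s' → s' ≤ t →
      Disjoint (Set.Ico (T.map^[s] (A s)) (T.map^[s] (A s) + (B s - A s)))
        (Set.Ico (T.map^[s'] (A s')) (T.map^[s'] (A s') + (B s' - A s'))) := by
    intro s s' hss hs't
    rw [Set.disjoint_left]
    intro w hw hw'
    obtain ⟨z, hz, rfl⟩ := himg s w hw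
    obtain ⟨z', hz', heq⟩ := himg s' _ hw'
    obtain ⟨k, rfl⟩ := Nat.exists_eq_add_of_le hss.le
    rw [Function.iterate_add_apply] at heq
    have hz'm := (hAB _).subset hT.pos hz'
    have h1 := iterate_injOn hT.pos s (iterate_mem hT.pos hz'm k)
      ((hAB s).subset hT.pos hz) heq
    refine hav k (by omega) (by omega) (h.iterate_mem_iff hT.pos (hAB (s + k)) hz'
      (hyAB (s + k)) (by omega) ?_)
    rw [h1]
    exact hsub s hz
  have hsum : ∑ s ∈ Finset.range (t + 1), (B s - A s) ≤ T.total := by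
    refine sum_length_le _ (fun s => T.map^[s] (A s)) _ (fun s _ => ?_)
      (IEM.total_pos hT.pos).le (fun s _ w hw => ?_) fun s hs s' hs' hne => ?_
    · linarith [(hAB s).lt]
    · obtain ⟨z, hz, rfl⟩ := himg s w hw
      exact iterate_mem hT.pos ((hAB s).subset hT.pos hz) s
    · rw [Finset.mem_range] at hs hs'
      rcases lt_or_gt_of_ne hne with hlt | hlt
      · exact hdisj s s' hlt (by omega)
      · exact (hdisj s' s hlt (by omega)).symm
  have hlog : c * Real.log ((t + n + 1) / n) ≤ T.total := by
    refine le_trans ?_ hsum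
    refine (mul_le_mul_of_nonneg_left (log_div_le_sum n t hn) hc.le).trans ?_
    rw [Finset.mul_sum]
    refine Finset.sum_le_sum fun s _ => ?_
    have := div_le_length hD (by omega) (hAB s)
    push_cast at this
    rwa [mul_one_div]
  rw [mul_comm, ← le_div_iff₀ hc, Real.log_le_iff_le_exp (by positivity), div_le_iff₀ hn0] at hlog
  exact hlog

/-- The return times to a continuity interval of `T^n` are comparable to `n`. -/
theorem exists_return_le (hT : T.Good) (hc : 0 < c) (hD : ∀ n : ℕ, 1 ≤ n → c / n ≤ T.gap n)
    (hn : 1 ≤ n) (h : IsContInterval T n a b) {y : ℝ} (hy : y ∈ Set.Ico a b) :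
    ∃ j, 1 ≤ j ∧ j ≤ ⌊Real.exp (T.total / c) * n⌋₊ ∧ T.map^[j] y ∈ Set.Ico a b := by
  by_contra hcon
  push Not at hcon
  have h1 := hT.add_le_of_avoid hc hD hn h hy hcon
  have h2 := Nat.lt_floor_add_one (Real.exp (T.total / c) * n)
  have hn0 : (0 : ℝ) < n := by exact_mod_cast hn
  linarith

/-- Every orbit visits every continuity interval of `T^n` in a time comparable to `n`. -/
theorem exists_visit_le (hT : T.Good) (hc : 0 < c) (hD : ∀ n : ℕ, 1 ≤ n → c / n ≤ T.gap n)
    (hn : 1 ≤ n) (h : IsContInterval T n a b) {x : ℝ} (hx : x ∈ Set.Ico 0 T.total) :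
    ∃ j, 1 ≤ j ∧ j ≤ ⌊Real.exp (T.total / c) * n⌋₊ ∧ T.map^[j] x ∈ Set.Ico a b := by
  classical
  by_contra hcon
  push Not at hcon
  set t := ⌊Real.exp (T.total / c) * n⌋₊ with ht
  obtain ⟨A, B, hAB, hxAB⟩ := exists_isContInterval hT.pos (t + n) hx
  -- An orbit which starts in `[a, b)` follows that of `x` at some time `i`; consider its
  -- last visit of `[a, b)` before.
  obtain ⟨i, hi⟩ := hT.exists_iterate_mem (mem_Icc_of_mem_discont hT.pos hAB.left).1 hAB.lt
    (mem_Icc_of_mem_discont hT.pos hAB.right).2 (h.subset hT.pos h.left_mem)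
  have hi' : T.map^[i] a ∈ Set.Ico A B := ⟨hi.1.le, hi.2⟩
  set k := Nat.findGreatest (fun k => T.map^[k] a ∈ Set.Ico a b) i with hk
  have hk1 : T.map^[k] a ∈ Set.Ico a b :=
    Nat.findGreatest_spec (P := fun k => T.map^[k] a ∈ Set.Ico a b) (Nat.zero_le i) h.left_mem
  have hk2 : k ≤ i := Nat.findGreatest_le i
  obtain ⟨j, hj1, hj2, hj3⟩ := hT.exists_return_le hc hD hn h hk1
  rw [← Function.iterate_add_apply] at hj3
  rcases le_or_gt (j + k) i with hle | hgt
  · exact Nat.findGreatest_is_greatest (P := fun k => T.map^[k] a ∈ Set.Ico a b)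
      (show k < j + k by omega) hle hj3
  · obtain ⟨l, hl⟩ := Nat.exists_eq_add_of_lt hgt
    rw [hl, add_assoc, add_comm, Function.iterate_add_apply] at hj3
    exact hcon (l + 1) (by omega) (by omega)
      (h.iterate_mem_iff hT.pos hAB hi' hxAB (by omega) hj3)

/-- Among the `n` continuity intervals of `T^n` which start at preimages of a fixed singularity,
one has at most the average length `λ^* / n`. -/
theorem exists_short_isContInterval (hT : T.Good) (hn : 1 ≤ n) :
    ∃ a b, IsContInterval T n a b ∧ b - a ≤ T.total / n := by
  obtain ⟨β, hβ⟩ := hT.exists_p_pos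
  choose x hxm hx using fun j => exists_iterate_eq hT.pos j (p_mem hT.pos β)
  have hxd : ∀ j < n, x j ∈ T.discont n := fun j hj =>
    (mem_discont hT.pos).mpr (Or.inr (Or.inr ⟨hxm j, j, hj, β, hβ, hx j⟩))
  have hinj : ∀ i j, i < j → x i ≠ x j := by
    intro i j hij heq
    obtain ⟨k, rfl⟩ := Nat.exists_eq_add_of_le hij.le
    have h := hx (i + k)
    rw [← heq, add_comm, Function.iterate_add_apply, hx i] at h
    exact iterate_p_ne (α := β) (m := k) hT.pos hT.keane (by omega) hβ h
  choose a b hab hxab using fun j => exists_isContInterval hT.pos n (hxm j)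
  have hax : ∀ j < n, a j = x j := fun j hj =>
    le_antisymm (hxab j).1 (not_lt.mp fun h => (hab j).notMem _ h (hxab j).2 (hxd j hj))
  by_contra hcon
  push Not at hcon
  have hn0 : (0 : ℝ) < n := by exact_mod_cast hn
  have hsum : ∑ j ∈ Finset.range n, (b j - a j) ≤ T.total := by
    refine sum_length_le _ a _ (fun j _ => by linarith [(hab j).lt])
      (IEM.total_pos hT.pos).le (fun j _ => ?_) fun i hi j hj hij => ?_
    · rw [add_sub_cancel]; exact (hab j).subset hT.pos
    · rw [add_sub_cancel, add_sub_cancel, Set.disjoint_left]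
      intro z hz hz'
      have hne : a i ≠ a j := by
        rw [hax i (Finset.mem_range.mp hi), hax j (Finset.mem_range.mp hj)]
        rcases lt_or_gt_of_ne hij with h | h
        · exact hinj i j h
        · exact (hinj j i h).symm
      rcases lt_or_gt_of_ne hne with h | h
      · exact (hab i).notMem _ h (hz'.1.trans_lt hz.2) (hab j).left
      · exact (hab j).notMem _ h (hz.1.trans_lt hz'.2) (hab i).left
  have hlt : ∑ _j ∈ Finset.range n, T.total / n < ∑ j ∈ Finset.range n, (b j - a j) :=
    Finset.sum_lt_sum_of_nonempty ⟨0, Finset.mem_range.mpr hn⟩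
      fun j _ => hcon _ _ (hab j)
  rw [Finset.sum_const, Finset.card_range, nsmul_eq_mul, mul_div_cancel₀ _ hn0.ne'] at hlt
  linarith

/-- The leftmost continuity interval is short: its images have to visit a short continuity
interval of an earlier iterate, and are contained in it. -/
theorem exists_left_isContInterval (hT : T.Good) (hc : 0 < c)
    (hD : ∀ n : ℕ, 1 ≤ n → c / n ≤ T.gap n) (hn : 1 ≤ n) :
    ∃ b, IsContInterval T (⌊Real.exp (T.total / c) * n⌋₊ + n) 0 b ∧ b ≤ T.total / n := by
  have h0 : (0 : ℝ) ∈ Set.Ico 0 T.total := ⟨le_rfl, IEM.total_pos hT.pos⟩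
  obtain ⟨a₀, b₀, h₀, hlen⟩ := hT.exists_short_isContInterval hn
  obtain ⟨j, -, hj, hmem⟩ := hT.exists_visit_le hc hD hn h₀ h0
  obtain ⟨a, b, hab, h0ab⟩ :=
    exists_isContInterval hT.pos (⌊Real.exp (T.total / c) * n⌋₊ + n) h0
  obtain rfl : a = 0 := le_antisymm h0ab.1 (mem_Icc_of_mem_discont hT.pos hab.left).1
  refine ⟨b, hab, hlen.trans' ?_⟩
  by_contra hlt
  have hz : b₀ - T.map^[j] 0 ∈ Set.Ico 0 b := ⟨by linarith [hmem.2], by linarith [hmem.1]⟩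
  refine hab.not_lt_le hT.pos h0ab hz (j := j) (by omega) h₀.right hmem.2 ?_
  rw [hab.iterate_eq hT.pos hz (j := j) (by omega)]
  linarith

end Good

/-! ### Large gaps imply bounded type -/

namespace Good

variable [NeZero d] [DecidableEq 𝒜] {T : IEM 𝒜 d} {n : ℕ} {a b c : ℝ}

/-- Large gaps bound the return times from above. -/
theorem exists_height_mul_total_le (hT : T.Good) (hD : T.CondD) :
    ∃ C : ℝ, 0 < C ∧ ∀ m α, (T.height m α : ℝ) * (T.iter m).total ≤ C := by
  obtain ⟨c, hc, hD⟩ := hD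
  set E := Real.exp (T.total / c) with hE
  have hE0 : 0 < E := Real.exp_pos _
  have ht := IEM.total_pos hT.pos
  refine ⟨E * ((E + 1) * (2 * T.total)), by positivity, fun m α => ?_⟩
  have hm := hT.total_pos m
  have hmt := (hT.tower m).total_le
  set n := ⌈T.total / (T.iter m).total⌉₊ with hndef
  have hn : 1 ≤ n := Nat.one_le_iff_ne_zero.mpr (Nat.ceil_pos.mpr (by positivity)).ne'
  have hn0 : (0 : ℝ) < n := by exact_mod_cast hn
  have hn1 : T.total / n ≤ (T.iter m).total := by
    have := Nat.le_ceil (T.total / (T.iter m).total)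
    rw [div_le_iff₀ hm] at this
    rw [div_le_iff₀ hn0]
    linarith
  have hn2 : n * (T.iter m).total ≤ 2 * T.total := by
    have := (Nat.ceil_lt_add_one (show 0 ≤ T.total / (T.iter m).total by positivity)).le
    rw [← hndef] at this
    have h1 := mul_le_mul_of_nonneg_right this hm.le
    rw [add_mul, div_mul_cancel₀ _ hm.ne'] at h1
    linarith
  obtain ⟨b, hb, hbn⟩ := hT.exists_left_isContInterval hc hD hn
  have hp := p_mem_cell (hT.iter_pos m) α
  obtain ⟨j, hj1, hj2, hj3⟩ := hT.exists_visit_le hc hD (by omega) hb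
    ((hT.tower m).mem_total (cell_subset (hT.iter_pos m) α hp))
  have hle : T.height m α ≤ j := by
    by_contra hlt
    have := (hT.tower m).le_iterate α _ hp j hj1 (not_le.mp hlt)
    linarith [hj3.2]
  have h1 : (T.height m α : ℝ) ≤ E * ((E + 1) * n) := by
    have h2 : ((⌊E * n⌋₊ + n : ℕ) : ℝ) ≤ (E + 1) * n := by
      push_cast
      linarith [Nat.floor_le (show 0 ≤ E * n by positivity)]
    have h3 : (j : ℝ) ≤ E * ((⌊E * n⌋₊ + n : ℕ) : ℝ) :=
      (Nat.cast_le.mpr hj2).trans (Nat.floor_le (by positivity))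
    exact (Nat.cast_le.mpr hle).trans (h3.trans (mul_le_mul_of_nonneg_left h2 hE0.le))
  calc (T.height m α : ℝ) * (T.iter m).total ≤ E * ((E + 1) * n) * (T.iter m).total :=
        mul_le_mul_of_nonneg_right h1 hm.le
    _ = E * ((E + 1) * (n * (T.iter m).total)) := by ring
    _ ≤ _ := by gcongr

/-- Large gaps bound the return times from below. -/
theorem le_height_mul_total (hT : T.Good) (hc : 0 < c) (hD : ∀ n : ℕ, 1 ≤ n → c / n ≤ T.gap n)
    (m : ℕ) (α : 𝒜) : c / 2 ≤ T.height m α * (T.iter m).total := by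
  have htow := hT.tower m
  have hp := p_mem_cell (hT.iter_pos m) α
  have hpm := cell_subset (hT.iter_pos m) α hp
  have hh : (0 : ℝ) < T.height m α := by exact_mod_cast htow.pos α
  have h1 := hT.div_le_displacement hc hD (htow.pos α) (htow.mem_total hpm)
  rw [htow.ret α _ hp, div_le_iff₀ (by positivity)] at h1
  have h2 := map_mem (hT.iter_pos m) hpm
  have h3 : |(T.iter m).map ((T.iter m).p α) - (T.iter m).p α| ≤ (T.iter m).total :=
    abs_sub_le_iff.mpr ⟨by linarith [h2.2, hpm.1], by linarith [hpm.2, h2.1]⟩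
  nlinarith

/-- If `α` is not the last letter of the top row, then both endpoints of its cell hit a
singularity of `T` within the return time. -/
theorem le_len_of_not_last (hT : T.Good) (hD : ∀ n : ℕ, 1 ≤ n → c / n ≤ T.gap n)
    {m R : ℕ} (hR : ∀ α, T.height m α ≤ R) {α : 𝒜} (hα : α ≠ (T.iter m).lastTop) :
    c / R ≤ (T.iter m).len α := by
  have htow := hT.tower m
  have hpos := hT.iter_pos m
  have hR1 : 1 ≤ R := (htow.pos α).trans_le (hR α)
  have hlt : (((T.iter m).top α : ℕ)) + 1 < d := lt_top_iff_val.mp (lt_top_of_ne top_lastTop hα)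
  have hmem : ∀ β, (T.iter m).p β ∈ T.discont R := by
    intro β
    obtain ⟨j, hj, γ, h1, h2⟩ := htow.sing β
    have hpm := cell_subset hpos β (p_mem_cell hpos β)
    rcases hpm.1.eq_or_lt with h0 | h0
    · exact (mem_discont hT.pos).mpr (Or.inl h0.symm)
    · exact (mem_discont hT.pos).mpr (Or.inr (Or.inr ⟨htow.mem_total hpm, j,
        hj.trans_le (hR β), γ, h2 h0, h1⟩))
  have hnext : (T.iter m).p ((T.iter m).top.symm ⟨_, hlt⟩) =
      (T.iter m).p α + (T.iter m).len α := offset_next (by simp)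
  have hl := hpos α
  have h1 := (hD R hR1).trans (gap_le (hmem ((T.iter m).top.symm ⟨_, hlt⟩)) (hmem α)
    (by rw [hnext]; linarith))
  rwa [hnext, add_sub_cancel_left, abs_of_pos hl] at h1

/-- Large gaps bound the lengths of all the letters except for the winner from below. -/
theorem le_len_of_ne_winner (hT : T.Good) (hc : 0 < c) (hD : ∀ n : ℕ, 1 ≤ n → c / n ≤ T.gap n)
    {m R : ℕ} (hR : ∀ α, T.height m α ≤ R) {α : 𝒜} (hα : α ≠ (T.iter m).winner) :
    c / (2 * R) ≤ (T.iter m).len α := by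
  have hpos := hT.iter_pos m
  have hR1 : (1 : ℝ) ≤ R := by exact_mod_cast ((hT.tower m).pos α).trans_le (hR α)
  by_cases hlast : α = (T.iter m).lastTop
  · rcases rauzy_cases (T.iter m) with ⟨hw, -⟩ | ⟨hw, hl, -, ht⟩
    · exact absurd (hlast.trans hw.symm) hα
    have hltop : (T.iter m).top (T.iter m).loser = ⊤ := by rw [hl, top_lastTop]
    have htw := insertAfter_last hltop (hT.winner_ne m)
    have hαl : α = (T.iter m).loser := hlast.trans hl.symm
    by_cases hnext : ((T.iter m).top (T.iter m).winner : ℕ) + 1 + 1 = d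
    · -- The cell of the winner is next to that of `α` and is translated by the length of `α`.
      have hp := p_mem_cell hpos (T.iter m).winner
      have htow := hT.tower m
      have h1 := hT.div_le_displacement hc hD (htow.pos (T.iter m).winner)
        (htow.mem_total (cell_subset hpos _ hp))
      have h2 : (T.iter m).p (T.iter m).loser =
          (T.iter m).p (T.iter m).winner + (T.iter m).len (T.iter m).winner :=
        offset_next (by have := val_top (d := d); rw [hltop]; omega)
      have h3 := p_lastTop (S := T.iter m)
      have h4 := q_lastBot (S := T.iter m)
      rw [← hl] at h3
      rw [← hw] at h4
      rw [htow.ret _ _ hp, map_of_mem_cell hpos hp, sub_self, zero_add,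
        show (T.iter m).q (T.iter m).winner - (T.iter m).p (T.iter m).winner =
          (T.iter m).len (T.iter m).loser by linarith, abs_of_pos (hpos _), ← hαl] at h1
      refine le_trans ?_ h1
      have h5 : (0 : ℝ) < T.height m (T.iter m).winner := by exact_mod_cast htow.pos _
      have h6 : (T.height m (T.iter m).winner : ℝ) ≤ R := by exact_mod_cast hR _
      gcongr
    · -- After the next arrow, `α` is not the last letter of the top row.
      have h1 : α ≠ (T.iter (m + 1)).lastTop := by
        intro h
        have h2 : (T.iter (m + 1)).top α = ⊤ := by rw [h, top_lastTop]
        have h3 := val_top (d := d)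
        rw [← h2, iter_succ, ht, hαl, htw] at h3
        exact hnext h3
      have h2 : ∀ β, T.height (m + 1) β ≤ 2 * R := by
        intro β
        by_cases hβ : β = (T.iter m).loser
        · subst hβ
          rw [height_loser_succ]
          have := hR (T.iter m).loser
          have := hR (T.iter m).winner
          omega
        · rw [height_succ_of_ne m hβ]
          have := hR β
          omega
      have h3 := hT.le_len_of_not_last hD h2 h1
      rw [len_succ_of_ne m hα] at h3
      exact_mod_cast h3
  · refine le_trans ?_ (hT.le_len_of_not_last hD hR hlast)
    exact div_le_div_of_nonneg_left hc.le (by linarith) (by linarith)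

theorem exists_mmyBoundedBy_of_condD (hT : T.Good) (hD : T.CondD) : ∃ M, T.MMYBoundedBy M := by
  obtain ⟨C, hC, hht⟩ := hT.exists_height_mul_total_le hD
  obtain ⟨c, hc, hD⟩ := hD
  refine ⟨∑ _β : 𝒜, ∑ _α : 𝒜, 4 * C ^ 2 / c ^ 2, fun k => ?_⟩
  have hlt := hT.mmyTime_lt k
  set m := T.mmyTime k with hm
  set m' := T.mmyTime (k + 1) with hm'
  obtain ⟨w, hw⟩ := hT.exists_not_winner_mmyTime k
  have hlen : ∀ i, m + i ≤ m' → (T.iter (m + i)).len w = (T.iter m).len w := by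
    intro i
    induction i with
    | zero => intro _; rfl
    | succ i ih =>
      intro hi
      rw [← ih (by omega), ← add_assoc, len_succ_of_ne _ (hw _ (by omega) (by omega)).symm]
  obtain ⟨α₀, -, hα₀⟩ := Finset.exists_max_image Finset.univ (T.height m)
    ⟨w, Finset.mem_univ w⟩
  have hR : ∀ α, T.height m α ≤ T.height m α₀ := fun α => hα₀ α (Finset.mem_univ α)
  have hR0 : (0 : ℝ) < T.height m α₀ := by exact_mod_cast (hT.tower m).pos α₀
  have ht := hT.total_pos m
  have ht' := hT.total_pos m'
  have h1 : c / (2 * T.height m α₀) ≤ (T.iter m').total := by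
    refine (hT.le_len_of_ne_winner hc hD hR (hw m le_rfl hlt).symm).trans ?_
    rw [← hlen (m' - m) (by omega), show m + (m' - m) = m' by omega]
    exact hT.len_le_total m' w
  have h2 : c * (T.iter m).total ≤ 2 * C * (T.iter m').total := by
    rw [div_le_iff₀ (by positivity)] at h1
    have := hht m α₀
    nlinarith
  refine Finset.sum_le_sum fun β _ => Finset.sum_le_sum fun α _ => ?_
  have hB0 : (0 : ℝ) ≤ T.B m m' β α := by exact_mod_cast B_nonneg m m' β α
  rw [abs_of_nonneg hB0, le_div_iff₀ (by positivity)]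
  have h3 : (T.B m m' β α : ℝ) * T.height m α ≤ T.height m' β := by
    have : T.B m m' β α * T.height m α ≤ T.height m' β := by
      rw [height_eq hlt.le]
      exact Finset.single_le_sum (f := fun γ => T.B m m' β γ * (T.height m γ : ℤ))
        (fun γ _ => mul_nonneg (B_nonneg _ _ _ _) (Int.natCast_nonneg _)) (Finset.mem_univ α)
    exact_mod_cast this
  have h4 := hT.le_height_mul_total hc hD m α
  have h5 := hht m' β
  -- The return times at both moments are comparable to the inverse of the total length.
  have h6 : (T.B m m' β α : ℝ) * (c / 2) ≤ T.height m' β * (T.iter m).total :=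
    (mul_le_mul_of_nonneg_left h4 hB0).trans (by
      rw [← mul_assoc]; exact mul_le_mul_of_nonneg_right h3 ht.le)
  have h7 : (T.height m' β : ℝ) * (c * (T.iter m).total) ≤ 2 * C * C := by
    calc (T.height m' β : ℝ) * (c * (T.iter m).total)
        ≤ T.height m' β * (2 * C * (T.iter m').total) :=
          mul_le_mul_of_nonneg_left h2 (Nat.cast_nonneg _)
      _ = 2 * C * (T.height m' β * (T.iter m').total) := by ring
      _ ≤ 2 * C * C := by gcongr
  nlinarith

end Good

/-! ### Long runs of arrows with the same winner -/

theorem offset_add_len_add_sum {ι : Type*} [Fintype ι] (e : ι ≃ Fin d) (len : ι → ℝ) (α : ι) :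
    offset e len α + len α + ∑ β with e α < e β, len β = ∑ β, len β := by
  rw [offset_add_len, ← Finset.sum_filter_add_sum_filter_not Finset.univ (fun β => e β ≤ e α)]
  simp only [not_le]

section Run

variable {ι : Type*} [NeZero d] {e : ℕ → ι ≃ Fin d} {l : ℕ → ι} {w : ι} {m m' : ℕ}

/-- During a run of Rauzy–Veech steps in a row with the same winner `w`, the letters after `w`
lose cyclically: each of them at least once in any `d` consecutive steps. -/
theorem exists_loser_eq (hne : ∀ i, w ≠ l i) (hl : ∀ i, m ≤ i → i < m' → e i (l i) = ⊤)
    (he : ∀ i, m ≤ i → i < m' → e (i + 1) = (e i).trans (insertAfter (e i w))) (t : ℕ) {i : ℕ}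
    (hi : m ≤ i) (hit : i + t + 1 ≤ m') {β : ι} (hβ : e i w < e i β) (ht : d ≤ e i β + t + 1) :
    ∃ j, i ≤ j ∧ j < i + t + 1 ∧ l j = β := by
  induction t generalizing i with
  | zero =>
    refine ⟨i, le_rfl, by omega, (e i).injective (Fin.ext ?_)⟩
    have h1 := val_top (d := d)
    have h2 := (e i β).isLt
    rw [hl i hi (by omega)]
    omega
  | succ t ih =>
    by_cases h : l i = β
    · exact ⟨i, le_rfl, by omega, h⟩
    · have h1 := insertAfter_of_lt (hl i hi (by omega)) (hne i) hβ (Ne.symm h)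
      have h2 := insertAfter_of_le (hl i hi (by omega)) (hne i) le_rfl
      rw [← he i hi (by omega)] at h1 h2
      obtain ⟨j, h3, h4, h5⟩ := ih (i := i + 1) (by omega) (by omega)
        (by rw [Fin.lt_def] at *; omega) (by omega)
      exact ⟨j, by omega, by omega, h5⟩

theorem lt_iff_of_run (hne : ∀ i, w ≠ l i) (hl : ∀ i, m ≤ i → i < m' → e i (l i) = ⊤)
    (he : ∀ i, m ≤ i → i < m' → e (i + 1) = (e i).trans (insertAfter (e i w))) {i : ℕ}
    (hi : m ≤ i) (him : i ≤ m') {β : ι} (hβ : e m w < e m β) : e i w < e i β := by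
  induction i, hi using Nat.le_induction with
  | base => exact hβ
  | succ i hi ih =>
    have h1 := ih (by omega)
    have h2 := insertAfter_of_le (hl i hi (by omega)) (hne i) (le_refl (e i w))
    rw [Fin.lt_def, he i hi (by omega), h2]
    by_cases h : β = l i
    · rw [h, insertAfter_last (hl i hi (by omega)) (hne i)]; omega
    · rw [insertAfter_of_lt (hl i hi (by omega)) (hne i) h1 h]
      rw [Fin.lt_def] at h1
      omega

end Run

namespace Good

variable [NeZero d] [DecidableEq 𝒜] {T : IEM 𝒜 d}

theorem len_run {m m' : ℕ} {α : 𝒜} (hα : ∀ i, m ≤ i → i < m' → (T.iter i).winner = α)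
    {i : ℕ} (hi : m ≤ i) (him : i ≤ m') {β : 𝒜} (hβ : β ≠ α) :
    (T.iter i).len β = (T.iter m).len β := by
  induction i, hi using Nat.le_induction with
  | base => rfl
  | succ i hi ih => rw [← ih (by omega), len_succ_of_ne i (by rwa [hα i hi (by omega)])]

/-- A run of at least `ld` arrows with the winner `α` subtracts from its length at least `l`
times the total length of the letters after `α` in the row which changes. -/
theorem mul_sum_le_len (hT : T.Good) {m m' : ℕ} {α : 𝒜}
    (hα : ∀ i, m ≤ i → i < m' → (T.iter i).winner = α) {e : ℕ → 𝒜 ≃ Fin d}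
    (hl : ∀ i, m ≤ i → i < m' → e i (T.iter i).loser = ⊤)
    (he : ∀ i, m ≤ i → i < m' → e (i + 1) = (e i).trans (insertAfter (e i α)))
    {l : ℕ} (hlm : m + l * d ≤ m') :
    l * ∑ β with e m α < e m β, (T.iter m).len β ≤ (T.iter m).len α := by
  -- The losers at the arrows outside the run are irrelevant.
  let f : ℕ → 𝒜 := fun i => if (T.iter i).winner = α then (T.iter i).loser else
    (hT.exists_ne_letter α).choose
  have hf : ∀ i, m ≤ i → i < m' → f i = (T.iter i).loser := fun i h1 h2 => if_pos (hα i h1 h2)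
  have hfne : ∀ i, α ≠ f i := by
    intro i
    by_cases h : (T.iter i).winner = α
    · simp only [f, if_pos h]; rw [← h]; exact hT.winner_ne i
    · simp only [f, if_neg h]; exact (hT.exists_ne_letter α).choose_spec.symm
  have hfl : ∀ i, m ≤ i → i < m' → e i (f i) = ⊤ := fun i h1 h2 => by
    rw [hf i h1 h2]; exact hl i h1 h2
  have hstep : ∀ i, m ≤ i → ∀ t, i + t ≤ m' → (T.iter (i + t)).len α = (T.iter i).len α -
      ∑ j ∈ Finset.range t, (T.iter m).len (f (i + j)) := by
    intro i hi t
    induction t with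
    | zero => intro _; simp
    | succ t ih =>
      intro ht
      have h1 := len_winner_succ (T := T) (i + t)
      rw [hα (i + t) (by omega) (by omega), ← hf (i + t) (by omega) (by omega),
        len_run hα (by omega) (by omega) (hfne (i + t)).symm, ih (by omega)] at h1
      rw [← add_assoc, h1, Finset.sum_range_succ]
      ring
  have hblock : ∀ i, m ≤ i → i + d ≤ m' → ∑ β with e m α < e m β, (T.iter m).len β ≤
      ∑ j ∈ Finset.range d, (T.iter m).len (f (i + j)) := by
    intro i hi hid
    have hd := hT.two_le
    have hex : ∀ β, ∃ j, e m α < e m β → j < d ∧ f (i + j) = β := by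
      intro β
      by_cases hβ : e m α < e m β
      · obtain ⟨j, h1, h2, h3⟩ := exists_loser_eq hfne hfl he (d - 1) hi (by omega)
          (lt_iff_of_run hfne hfl he hi (by omega) hβ) (by omega)
        exact ⟨j - i, fun _ => ⟨by omega, by rw [show i + (j - i) = j by omega, h3]⟩⟩
      · exact ⟨0, fun h => absurd h hβ⟩
    choose g hg using hex
    have hgmem : ∀ β ∈ Finset.univ.filter (fun β => e m α < e m β),
        g β < d ∧ f (i + g β) = β := fun β hβ => hg β (Finset.mem_filter.mp hβ).2
    calc ∑ β with e m α < e m β, (T.iter m).len β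
        = ∑ β with e m α < e m β, (T.iter m).len (f (i + g β)) :=
          Finset.sum_congr rfl fun β hβ => by rw [(hgmem β hβ).2]
      _ = ∑ j ∈ (Finset.univ.filter (fun β => e m α < e m β)).image g,
            (T.iter m).len (f (i + j)) := by
          rw [Finset.sum_image]
          intro β hβ γ hγ h
          rw [← (hgmem β hβ).2, ← (hgmem γ hγ).2, h]
      _ ≤ _ := by
          refine Finset.sum_le_sum_of_subset_of_nonneg ?_ fun j _ _ => (hT.iter_pos m _).le
          intro j hj
          obtain ⟨β, hβ, rfl⟩ := Finset.mem_image.mp hj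
          exact Finset.mem_range.mpr (hgmem β hβ).1
  have key : ∀ k, m + k * d ≤ m' → k * ∑ β with e m α < e m β, (T.iter m).len β +
      (T.iter (m + k * d)).len α ≤ (T.iter m).len α := by
    intro k
    induction k with
    | zero => intro _; simp
    | succ k ih =>
      intro hk
      have hk' : m + k * d + d ≤ m' := by rw [add_assoc, ← Nat.succ_mul]; exact hk
      have h1 := ih (by omega)
      have h2 := hstep (m + k * d) (by omega) d hk'
      have h3 := hblock (m + k * d) (by omega) hk'
      rw [Nat.succ_mul, ← add_assoc, h2]
      push_cast
      linarith
  have := key l hlm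
  linarith [hT.iter_pos (m + l * d) α]

/-- In a long run of arrows with the winner `α`, the initial induced map moves
the points of the cell of `α` by a distance which is short in comparison with this cell. -/
theorem mul_displacement_le_len (hT : T.Good) {m m' : ℕ} {α : 𝒜} (hmm : m < m')
    (hα : ∀ i, m ≤ i → i < m' → (T.iter i).winner = α) {l : ℕ} (hlm : m + l * d ≤ m') :
    l * |(T.iter m).q α - (T.iter m).p α| ≤ (T.iter m).len α := by
  have hlen : ∀ i, 0 < (T.iter m).len i := hT.iter_pos m
  have htot : ∀ e : 𝒜 ≃ Fin d, offset e (T.iter m).len α + (T.iter m).len α +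
      ∑ β with e α < e β, (T.iter m).len β = (T.iter m).total :=
    fun e => offset_add_len_add_sum e _ α
  rcases rauzy_cases (T.iter m) with ⟨hw, -⟩ | ⟨hw, -⟩
  · have htype : ∀ i, m ≤ i → i < m' → (T.iter i).lastTop = α := by
      intro i hi
      induction i, hi using Nat.le_induction with
      | base => intro _; rw [← hw]; exact hα m le_rfl hmm
      | succ i hi ih =>
        intro him
        have h1 := ih (by omega)
        rcases rauzy_cases (T.iter i) with ⟨-, -, h3, -⟩ | ⟨h2, -⟩
        · rw [iter_succ, lastTop, h3]; exact h1
        · rw [hα i hi (by omega)] at h2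
          exact absurd (h1.trans h2) (hT.lastTop_ne i)
    have hrow : ∀ i, m ≤ i → i < m' → (T.iter i).bot (T.iter i).loser = ⊤ ∧
        (T.iter (i + 1)).bot = (T.iter i).bot.trans (insertAfter ((T.iter i).bot α)) := by
      intro i hi him
      rcases rauzy_cases (T.iter i) with ⟨h1, h2, h3, h4⟩ | ⟨h2, -⟩
      · rw [h2, bot_lastBot, iter_succ, h4, hα i hi him]
        exact ⟨rfl, rfl⟩
      · rw [hα i hi him] at h2
        exact absurd ((htype i hi him).trans h2) (hT.lastTop_ne i)
    have h1 := hT.mul_sum_le_len hα (e := fun i => (T.iter i).bot)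
      (fun i h2 h3 => (hrow i h2 h3).1) (fun i h2 h3 => (hrow i h2 h3).2) hlm
    have h2 : (T.iter m).p α + (T.iter m).len α = (T.iter m).total := by
      rw [← htype m le_rfl hmm]; exact p_lastTop
    have h3 := htot (T.iter m).bot
    rw [← q_eq_offset] at h3
    have h4 : 0 ≤ ∑ β with (T.iter m).bot α < (T.iter m).bot β, (T.iter m).len β :=
      Finset.sum_nonneg fun β _ => (hlen β).le
    rwa [abs_of_nonpos (by linarith), show -((T.iter m).q α - (T.iter m).p α) =
      ∑ β with (T.iter m).bot α < (T.iter m).bot β, (T.iter m).len β by linarith]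
  · have htype : ∀ i, m ≤ i → i < m' → (T.iter i).lastBot = α := by
      intro i hi
      induction i, hi using Nat.le_induction with
      | base => intro _; rw [← hw]; exact hα m le_rfl hmm
      | succ i hi ih =>
        intro him
        have h1 := ih (by omega)
        rcases rauzy_cases (T.iter i) with ⟨h2, -⟩ | ⟨-, -, h3, -⟩
        · rw [hα i hi (by omega)] at h2
          exact absurd (h2.symm.trans h1.symm) (hT.lastTop_ne i)
        · rw [iter_succ, lastBot, h3]; exact h1
    have hrow : ∀ i, m ≤ i → i < m' → (T.iter i).top (T.iter i).loser = ⊤ ∧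
        (T.iter (i + 1)).top = (T.iter i).top.trans (insertAfter ((T.iter i).top α)) := by
      intro i hi him
      rcases rauzy_cases (T.iter i) with ⟨h2, -⟩ | ⟨h1, h2, h3, h4⟩
      · rw [hα i hi him] at h2
        exact absurd (h2.symm.trans (htype i hi him).symm) (hT.lastTop_ne i)
      · rw [h2, top_lastTop, iter_succ, h4, hα i hi him]
        exact ⟨rfl, rfl⟩
    have h1 := hT.mul_sum_le_len hα (e := fun i => (T.iter i).top)
      (fun i h2 h3 => (hrow i h2 h3).1) (fun i h2 h3 => (hrow i h2 h3).2) hlm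
    have h2 : (T.iter m).q α + (T.iter m).len α = (T.iter m).total := by
      rw [← htype m le_rfl hmm]; exact q_lastBot
    have h3 := htot (T.iter m).top
    rw [← p_eq_offset] at h3
    have h4 : 0 ≤ ∑ β with (T.iter m).top α < (T.iter m).top β, (T.iter m).len β :=
      Finset.sum_nonneg fun β _ => (hlen β).le
    rwa [abs_of_nonneg (by linarith), show (T.iter m).q α - (T.iter m).p α =
      ∑ β with (T.iter m).top α < (T.iter m).top β, (T.iter m).len β by linarith]

end Good

/-! ### Large displacements imply bounded Zorich matrices -/

namespace Good

variable [NeZero d] [DecidableEq 𝒜] {T : IEM 𝒜 d}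

/-- If the runs of arrows with the same winner are unbounded, then every interval contains an
interval of points which some high iterate `T^n` moves by less than `ε / n`. -/
theorem exists_Icc_displacement_lt (hT : T.Good)
    (hrun : ∀ L, ∃ k, L < T.zorichTime (k + 1) - T.zorichTime k) {a b : ℝ} (ha : 0 ≤ a)
    (hab : a < b) (hb : b ≤ T.total) {ε : ℝ} (hε : 0 < ε) (N : ℕ) :
    ∃ a' b', a < a' ∧ a' < b' ∧ b' < b ∧
      ∃ n ≥ N, ∀ y ∈ Set.Icc a' b', n * |T.map^[n] y - y| < ε := by
  have htot := IEM.total_pos hT.pos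
  obtain ⟨m₁, hm₁⟩ := hT.exists_floor_subset ha hab hb
  obtain ⟨m₂, hm₂⟩ := hT.exists_le_height N
  obtain ⟨l, hl⟩ := exists_nat_gt (T.total / ε + 1)
  have hl1 : (1 : ℝ) < l := by linarith [div_pos htot hε]
  -- A long run which starts late.
  obtain ⟨k, hk⟩ := hrun (l * d + ∑ k ∈ Finset.range (m₁ + m₂),
    (T.zorichTime (k + 1) - T.zorichTime k))
  have hkm : m₁ + m₂ ≤ k := by
    by_contra hlt
    have := Finset.single_le_sum (f := fun k => T.zorichTime (k + 1) - T.zorichTime k)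
      (fun _ _ => Nat.zero_le _) (Finset.mem_range.mpr (not_le.mp hlt))
    omega
  have hkz : k ≤ T.zorichTime k := hT.zorichTime_strictMono.le_apply
  obtain ⟨hlt, α, hα⟩ := hT.zorichTime_mem k
  set m := T.zorichTime k with hm
  have hD := hT.mul_displacement_le_len hlt hα (l := l) (by omega)
  set D := (T.iter m).q α - (T.iter m).p α with hDdef
  have hpos := hT.iter_pos m
  have htow := hT.tower m
  have hlen := hpos α
  obtain ⟨i, hi, hmem⟩ := hm₁ m (by omega) α
  set P := (T.iter m).p α with hP
  set lam := (T.iter m).len α with hlam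
  have hDlt : |D| < lam := by
    rcases (abs_nonneg D).eq_or_lt with h | h
    · rw [← h]; exact hlen
    · nlinarith
  set u₀ := P + max 0 (-D) with hu₀
  have hX : ∀ x, u₀ ≤ x → x < u₀ + (lam - |D|) → x ∈ (T.iter m).cell α ∧
      x + D ∈ (T.iter m).cell α := by
    intro x h1 h2
    have hcell : (T.iter m).cell α = Set.Ico P (P + lam) := rfl
    rw [hcell, Set.mem_Ico, Set.mem_Ico]
    rcases le_total 0 D with h | h
    · rw [max_eq_left (by linarith)] at hu₀
      rw [abs_of_nonneg h] at h2
      refine ⟨⟨?_, ?_⟩, ?_, ?_⟩ <;> linarith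
    · rw [max_eq_right (by linarith)] at hu₀
      rw [abs_of_nonpos h] at h2
      refine ⟨⟨?_, ?_⟩, ?_, ?_⟩ <;> linarith
  set w := (lam - |D|) / 3 with hw
  have hw0 : 0 < w := by rw [hw]; linarith
  have hu := hX (u₀ + w) (by linarith) (by linarith)
  have hv := hX (u₀ + 2 * w) (by linarith) (by linarith)
  have huv := htow.iterate_sub hT.pos hu.1 hv.1 hi.le
  refine ⟨T.map^[i] (u₀ + w), T.map^[i] (u₀ + 2 * w), (hmem _ hu.1).1, by linarith,
    (hmem _ hv.1).2, T.height m α, hm₂ m (by omega) α, ?_⟩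
  intro y hy
  have hx := hX (u₀ + w + (y - T.map^[i] (u₀ + w))) (by linarith [hy.1]) (by linarith [hy.2])
  set x := u₀ + w + (y - T.map^[i] (u₀ + w)) with hxdef
  have hxy : T.map^[i] x = y := by
    have := htow.iterate_sub hT.pos hx.1 hu.1 hi.le
    linarith
  have hmove : T.map^[T.height m α] y = y + D := by
    have h1 := htow.iterate_sub hT.pos hx.2 hx.1 hi.le
    rw [← hxy, ← Function.iterate_add_apply, add_comm, Function.iterate_add_apply,
      htow.ret α x hx.1, map_of_mem_cell hpos hx.1,
      show x - (T.iter m).p α + (T.iter m).q α = x + D by rw [hDdef]; ring]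
    linarith
  have hh : (T.height m α : ℝ) * lam ≤ T.total := by
    rw [hT.total_eq_sum m, mul_comm]
    exact Finset.single_le_sum (f := fun β => (T.iter m).len β * (T.height m β : ℝ))
      (fun β _ => mul_nonneg (hpos β).le (Nat.cast_nonneg _)) (Finset.mem_univ α)
  rw [hmove, add_sub_cancel_left]
  have h1 : (l : ℝ) * (T.height m α * |D|) ≤ T.total := by
    calc (l : ℝ) * (T.height m α * |D|) = T.height m α * (l * |D|) := by ring
      _ ≤ T.height m α * lam := mul_le_mul_of_nonneg_left hD (Nat.cast_nonneg _)
      _ ≤ _ := hh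
  have h2 : T.total < l * ε := by
    rw [← div_lt_iff₀ hε]; linarith
  exact lt_of_mul_lt_mul_left (h1.trans_lt h2) (by linarith)

theorem exists_zorichBoundedBy_of_condU (hT : T.Good) (hU : T.CondU) :
    ∃ M, T.ZorichBoundedBy M := by
  by_cases hrun : ∃ L, ∀ k, T.zorichTime (k + 1) - T.zorichTime k ≤ L
  · obtain ⟨L, hL⟩ := hrun
    obtain ⟨K, hK1, hK⟩ := exists_entryNorm_B_le T
    refine ⟨K ^ (L + 1), fun k => ?_⟩
    have h1 := hK (T.zorichTime k) (T.zorichTime (k + 1) - T.zorichTime k)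
    rw [Nat.add_sub_of_le (hT.zorichTime_mem k).1.le] at h1
    exact h1.trans (pow_le_pow_right₀ hK1 (by have := hL k; omega))
  · exfalso
    push Not at hrun
    obtain ⟨c, hc, hU⟩ := hU
    -- Nested intervals of points which are moved less and less, in relation to the time.
    let Int := {I : ℝ × ℝ // 0 ≤ I.1 ∧ I.1 < I.2 ∧ I.2 ≤ T.total}
    have hnext : ∀ (j : ℕ) (I : Int), ∃ J : Int, I.1.1 < J.1.1 ∧ J.1.2 < I.1.2 ∧
        ∃ n ≥ j, ∀ y ∈ Set.Icc J.1.1 J.1.2, n * |T.map^[n] y - y| < 1 / ((j : ℝ) + 1) := by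
      intro j I
      obtain ⟨a, b, h1, h2, h3, h4⟩ := hT.exists_Icc_displacement_lt hrun I.2.1 I.2.2.1 I.2.2.2
        (ε := 1 / ((j : ℝ) + 1)) (by positivity) j
      exact ⟨⟨(a, b), I.2.1.trans h1.le, h2, h3.le.trans I.2.2.2⟩, h1, h3, h4⟩
    choose F hF1 hF2 hF3 using hnext
    let I : ℕ → Int := fun j => Nat.rec
      ⟨(0, T.total), le_rfl, IEM.total_pos hT.pos, le_rfl⟩ (fun j J => F j J) j
    have hI : ∀ j, I (j + 1) = F j (I j) := fun j => rfl
    obtain ⟨x, hx⟩ := IsCompact.nonempty_iInter_of_sequence_nonempty_isCompact_isClosed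
      (fun j => Set.Icc (I j).1.1 (I j).1.2)
      (fun j => Set.Icc_subset_Icc (by rw [hI]; exact (hF1 j (I j)).le)
        (by rw [hI]; exact (hF2 j (I j)).le))
      (fun j => Set.nonempty_Icc.mpr (I j).2.2.1.le) isCompact_Icc fun j => isClosed_Icc
    rw [Set.mem_iInter] at hx
    have hx0 : x ∈ Set.Ico 0 T.total :=
      ⟨(hx 0).1, (hx 1).2.trans_lt (hF2 0 (I 0))⟩
    have hlim := hU x hx0
    have hlt : ((c / 2 : ℝ) : EReal) <
        liminf (fun n : ℕ => ((n * |T.map^[n] x - x| : ℝ) : EReal)) atTop :=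
      lt_of_lt_of_le (EReal.coe_lt_coe_iff.mpr (by linarith)) hlim
    obtain ⟨N, hN⟩ := eventually_atTop.mp (eventually_lt_of_lt_liminf hlt)
    obtain ⟨j, hj⟩ := exists_nat_one_div_lt (show 0 < c / 2 by linarith)
    obtain ⟨n, hn, hxn⟩ := hF3 (N + j) (I (N + j))
    have h1 := hxn x (hx (N + j + 1))
    have h2 := EReal.coe_lt_coe_iff.mp (hN n (by omega))
    have h3 : 1 / (((N + j : ℕ) : ℝ) + 1) ≤ 1 / ((j : ℝ) + 1) := by
      apply one_div_le_one_div_of_le (by positivity)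
      push_cast
      linarith [Nat.cast_nonneg (α := ℝ) N]
    linarith

end Good

end IEM

theorem mainTheorem1 {𝒜 : Type*} [Fintype 𝒜] [DecidableEq 𝒜] {d : ℕ} [NeZero d] (hd : 2 ≤ d)
    (T : IEM 𝒜 d) (hpos : T.Positive) (hadm : T.Admissible) (hkeane : T.Keane) :
    ((∃ M : ℝ, T.MMYBoundedBy M) ↔ T.CondD) ∧
    (∀ M : ℝ, T.MMYBoundedBy M → ∀ n : ℕ, 1 ≤ n →
      T.total / (M ^ (4 * max (2 * d - 3) 2) * n) < T.gap n) ∧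
    (T.CondD → T.CondU) ∧
    (T.CondU → ∃ M : ℝ, T.ZorichBoundedBy M) := by
  have hT : T.Good := ⟨hd, hpos, hadm, hkeane⟩
  refine ⟨⟨?_, hT.exists_mmyBoundedBy_of_condD⟩, fun M hM n hn => hT.lt_gap_of_mmyBoundedBy hM hn,
    hT.condU_of_condD, hT.exists_zorichBoundedBy_of_condU⟩
  rintro ⟨M, hM⟩
  have hM1 := hT.one_lt_of_mmyBoundedBy hM
  refine ⟨T.total / M ^ (4 * max (2 * d - 3) 2),
    div_pos (IEM.total_pos hpos) (pow_pos (by linarith) _), fun n hn => ?_⟩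
  rw [div_div]
  exact (hT.lt_gap_of_mmyBoundedBy hM hn).le

end
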